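/- Let $p>2$ be a prime, let $k$ be an algebraically closed field of characteristic $p$, and let $G=\mathrm{SL}_2(\mathbb{F}_p)$. For $n\ge 1$ let $V_n$ be the $kG$-module of homogeneous polynomials over $k$ of degree $n-1$ in $X,Y$, with action $\begin{pmatrix}a&b\\c&d\end{pmatrix}f(X,Y)=f(aX+cY,\,bX+dY)$. For $n\in\{1,\dots,p-1\}$ let $A=A^{(n)}$ be the matrix with rows and columns indexed by $1,\dots,p-1$ whose entry $A_{i,j}$ is the multiplicity of $V_j$ as an indecomposable summand of $V_i\otimes_k V_n$. Let $\bar A=\bar A^{(n)}$ be the $\frac{p-1}{2}\times\frac{p-1}{2}$ matrix with $\bar A_{i,j}=A_{2i-1,\,2j-1}$ if $n$ is odd and $\bar A_{i,j}=A_{2i-1,\,p+1-2j}$ if $n$ is even. Then the following hold. 1. $A$ is a symmetric matrix with entries in $\{0,1\}$. So there is an undirected graph $\mathcal G=\mathcal G^{(n)}$ (with loops) on the vertices $1,\dots,p-1$ whose adjacency matrix is $A$. 2. If $n$ is odd, then $\mathcal G$ is disconnected, and each connected component is a subset of the odd integers or of the even integers. 3. If $n$ is even, then $\mathcal G$ is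 bipartite, with classes the odd integers and the even integers. 4. When the vertices are ordered as $1,3,\dots,p-2,p-1,p-3,\dots,4,2$, we have $$A=\bar A\otimes\begin{pmatrix}0&1\\1&0\end{pmatrix}^{n+1},$$ where, for a $2\times 2$ matrix $B=(b_{st})$, $\bar A\otimes B$ denotes the $2\times2$ block matrix $\begin{pmatrix}b_{11}\bar A&b_{12}\bar A\\b_{21}\bar A&b_{22}\bar A\end{pmatrix}$. 5. If $n$ is odd and $n>1$, then $\mathcal G$ has precisely two connected components, whose vertex sets are the odd integers and the even integers in $\{1,\dots,p-1\}$, and these two components are isomorphic as graphs with loops. 6. If $n$ is even and $n<p-1$, then $\mathcal G$ is connected. -/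

import Mathlib

open MvPolynomial

namespace SL2Tensor

/-! ### Multiplicities as indecomposable summands -/

section Multiplicity

variable (R : Type*) [Ring R]

/-- A module is indecomposable if it is nonzero and is not the direct sum of two nonzero
submodules. -/
def IsIndecomposable (M : Type*) [AddCommGroup M] [Module R M] : Prop :=
  Nontrivial M ∧ ∀ N₁ N₂ : Submodule R M, IsCompl N₁ N₂ → N₁ = ⊥ ∨ N₂ = ⊥

/-- `M` has a decomposition as an internal direct sum of finitely many indecomposable submodules,
of which precisely `m` are isomorphic to `V`. -/
def HasDecompositionWith (V M : Type*) [AddCommGroup V] [Module R V] [AddCommGroup M] [Module R M]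
    (m : ℕ) : Prop :=
  ∃ (s : ℕ) (N : Fin s → Submodule R M), DirectSum.IsInternal N ∧
    (∀ t, IsIndecomposable R (N t)) ∧ Nat.card {t : Fin s // Nonempty (N t ≃ₗ[R] V)} = m

/-- The multiplicity of `V` as an indecomposable summand of `M`: the number of summands
isomorphic to `V` in a decomposition of `M` into indecomposable summands. For modules of finite
length, decompositions exist and this number is the same for all of them (Krull-Schmidt), so that
the supremum is over a set with exactly one element. -/
noncomputable def multiplicity (V M : Type*) [AddCommGroup V] [Module R V]
    [AddCommGroup M] [Module R M] : ℕ :=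
  sSup {m : ℕ | HasDecompositionWith R V M m}

end Multiplicity

/-! ### The modules `V_n` for `SL₂(𝔽_p)` -/

section Modules

variable (k : Type*) [Field k] (p : ℕ) [CharP k p]

/-- The group `SL₂(𝔽_p)`. -/
abbrev G (p : ℕ) : Type := Matrix.SpecialLinearGroup (Fin 2) (ZMod p)

/-- The entries of an element of `SL₂(𝔽_p)`, seen in the field `k` of characteristic `p`. -/
def entry (g : G p) (i j : Fin 2) : k := ZMod.castHom (dvd_refl p) k (g i j)

/-- For `g = (a b; c d)`, the pair of polynomials `aX + cY` and `bX + dY`, where `X` and `Y` are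
the variables with index `0` and `1`. -/
noncomputable def images (g : G p) : Fin 2 → MvPolynomial (Fin 2) k :=
  ![C (entry k p g 0 0) * X 0 + C (entry k p g 1 0) * X 1,
    C (entry k p g 0 1) * X 0 + C (entry k p g 1 1) * X 1]

/-- For `g = (a b; c d)`, the linear substitution `f(X, Y) ↦ f(aX + cY, bX + dY)`. -/
noncomputable def substitution (g : G p) : MvPolynomial (Fin 2) k →ₐ[k] MvPolynomial (Fin 2) k :=
  aeval (images k p g)

theorem substitution_one : substitution k p 1 = AlgHom.id k _ := by
  ext j : 1
  fin_cases j <;> simp [substitution, images, entry]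

theorem substitution_mul (g h : G p) :
    substitution k p (g * h) = (substitution k p g).comp (substitution k p h) := by
  ext j : 1
  fin_cases j <;>
    simp [substitution, images, entry, Matrix.mul_apply, Fin.sum_univ_two] <;> ring

theorem substitution_mem (g : G p) (d : ℕ) {f : MvPolynomial (Fin 2) k}
    (hf : f ∈ homogeneousSubmodule (Fin 2) k d) :
    substitution k p g f ∈ homogeneousSubmodule (Fin 2) k d := by
  have h : (substitution k p g f).IsHomogeneous (1 * d) := by
    refine MvPolynomial.IsHomogeneous.aeval hf (images k p g) ?_
    intro j
    fin_cases j
    · exact (isHomogeneous_C_mul_X (entry k p g 0 0) 0).add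
        (isHomogeneous_C_mul_X (entry k p g 1 0) 1)
    · exact (isHomogeneous_C_mul_X (entry k p g 0 1) 0).add
        (isHomogeneous_C_mul_X (entry k p g 1 1) 1)
  rwa [one_mul] at h

/-- The action of `SL₂(𝔽_p)` on all polynomials in `X` and `Y`. -/
noncomputable def polyRep : Representation k (G p) (MvPolynomial (Fin 2) k) where
  toFun g := (substitution k p g).toLinearMap
  map_one' := by rw [substitution_one]; rfl
  map_mul' g h := by rw [substitution_mul]; rfl

/-- For `n ≥ 1`, the space `V_n` of homogeneous polynomials of degree `n - 1` in `X` and `Y`. -/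
def V (k : Type*) [Field k] (n : ℕ) : Type _ := homogeneousSubmodule (Fin 2) k (n - 1)

noncomputable instance (n : ℕ) : AddCommGroup (V k n) :=
  Submodule.addCommGroup (homogeneousSubmodule (Fin 2) k (n - 1))

noncomputable instance (n : ℕ) : Module k (V k n) :=
  Submodule.module (homogeneousSubmodule (Fin 2) k (n - 1))

/-- For `n ≥ 1`, the representation of `SL₂(𝔽_p)` on `V_n`. -/
noncomputable def vRep (n : ℕ) : Representation k (G p) (V k n) :=
  (polyRep k p).subrepresentation (homogeneousSubmodule (Fin 2) k (n - 1))
    (fun g _ hf => substitution_mem k p g (n - 1) hf)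

/-- The multiplicity of `V_j` as an indecomposable summand of the `kG`-module `V_i ⊗ V_n`. -/
noncomputable def tensorMultiplicity (n i j : ℕ) : ℕ :=
  multiplicity (MonoidAlgebra k (G p)) (vRep k p j).asModule
    ((vRep k p i).tprod (vRep k p n)).asModule

end Modules

/-! ### The table of multiplicities and its graph -/

/-- The index set `[p - 1] = {1, …, p - 1}`. -/
abbrev Vertex (p : ℕ) : Type := Set.Icc 1 (p - 1)

section Graph

variable (k : Type*) [Field k] (p : ℕ) [CharP k p] (n : ℕ)

/-- The matrix `A⁽ⁿ⁾`, whose `(i, j)` entry is the multiplicity of `V_j` in `V_i ⊗ V_n`. -/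
noncomputable def A : Matrix (Vertex p) (Vertex p) ℕ :=
  Matrix.of fun i j => tensorMultiplicity k p n i j

/-- The graph `𝒢⁽ⁿ⁾` with adjacency matrix `A⁽ⁿ⁾`, as a directed graph with loops. -/
def graph : Digraph (Vertex p) where
  Adj i j := A k p n i j ≠ 0

/-- The set of odd vertices. -/
def oddVertices : Set (Vertex p) := {i | Odd (i : ℕ)}

/-- The set of even vertices. -/
def evenVertices : Set (Vertex p) := {i | Even (i : ℕ)}

/-- The simple graph of undirected edges of `𝒢⁽ⁿ⁾` that are not loops. It has the same
walks up to loops, hence the same connected components, as `𝒢⁽ⁿ⁾`. -/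
def simpleGraph : SimpleGraph (Vertex p) := (graph k p n).toSimpleGraphInclusive

/-- The subgraphs of `𝒢⁽ⁿ⁾` induced on two sets of vertices are isomorphic, as graphs with
loops. -/
def InducedIso (S T : Set (Vertex p)) : Prop :=
  Nonempty ((fun a b : S => (graph k p n).Adj a b) ≃r (fun a b : T => (graph k p n).Adj a b))

/-- `𝒢⁽ⁿ⁾` is bipartite with classes `S` and `T`: these partition the vertices, and no edge
(in particular, no loop) has both ends in the same class. -/
def IsBipartiteWithClasses (S T : Set (Vertex p)) : Prop :=
  IsCompl S T ∧ ∀ i j, (graph k p n).Adj i j → (i ∈ S ∧ j ∈ T) ∨ (i ∈ T ∧ j ∈ S)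

end Graph

/-! ### The reordered matrix -/

section Reordered

/-- The vertex `2i - 1`, for `i = t + 1` with `t = 0, …, (p - 1)/2 - 1`. -/
def oddVertex (p : ℕ) (t : Fin ((p - 1) / 2)) : Vertex p :=
  ⟨2 * t + 1, by have := t.2; constructor <;> omega⟩

/-- The vertex `p + 1 - 2i`, for `i = t + 1` with `t = 0, …, (p - 1)/2 - 1`. -/
def evenVertex (p : ℕ) (t : Fin ((p - 1) / 2)) : Vertex p :=
  ⟨p + 1 - 2 * (t + 1), by have := t.2; constructor <;> omega⟩

/-- The matrix `Ā⁽ⁿ⁾`. -/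
noncomputable def ABar (k : Type*) [Field k] (p : ℕ) [CharP k p] (n : ℕ) :
    Matrix (Fin ((p - 1) / 2)) (Fin ((p - 1) / 2)) ℕ :=
  Matrix.of fun i j =>
    if Odd n then A k p n (oddVertex p i) (oddVertex p j)
    else A k p n (oddVertex p i) (evenVertex p j)

/-- For odd `p`, the ordering `1, 3, …, p - 2, p - 1, p - 3, …, 4, 2` of the vertices: the
entry in position `t` (counted from `0`) is `2t + 1` in the first half, and `2(p - 1 - t)` in the
second half. -/
def ordering (p : ℕ) (hp : Odd p) : Fin (p - 1) ≃ Vertex p where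
  toFun t :=
    if h : 2 * (t : ℕ) < p - 1 then ⟨2 * t + 1, by constructor <;> omega⟩
    else ⟨2 * (p - 1 - t), by obtain ⟨m, rfl⟩ := hp; have := t.2; constructor <;> omega⟩
  invFun v :=
    if h : Odd (v : ℕ) then ⟨(v - 1) / 2, by have := v.2.1; have := v.2.2; omega⟩
    else ⟨p - 1 - v / 2, by
      have := v.2.1; have := v.2.2; rw [Nat.not_odd_iff_even] at h; obtain ⟨l, hl⟩ := h; omega⟩
  left_inv t := by
    obtain ⟨m, rfl⟩ := hp
    have := t.2
    by_cases h : 2 * (t : ℕ) < 2 * m + 1 - 1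
    · have ho : Odd (2 * (t : ℕ) + 1) := ⟨_, rfl⟩
      simp only [h, dite_true, ho]
      ext; simp
    · have he : ¬ Odd (2 * (2 * m + 1 - 1 - (t : ℕ))) := by
        rw [Nat.not_odd_iff_even]; exact even_two_mul _
      simp only [h, dite_false, he]
      ext; simp; omega
  right_inv v := by
    obtain ⟨m, rfl⟩ := hp
    have h1 := v.2.1
    have h2 := v.2.2
    by_cases h : Odd (v : ℕ)
    · have hv : 2 * (((v : ℕ) - 1) / 2) < 2 * m + 1 - 1 := by obtain ⟨l, hl⟩ := h; omega
      simp only [h, dite_true, hv]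
      ext; simp; obtain ⟨l, hl⟩ := h; omega
    · have he := Nat.not_odd_iff_even.1 h
      have hv : ¬ 2 * (2 * m + 1 - 1 - (v : ℕ) / 2) < 2 * m + 1 - 1 := by omega
      simp only [h, dite_false, hv]
      ext; simp; obtain ⟨l, hl⟩ := he; omega

/-- The positions of the rows and columns of the `2 × 2` block matrix with blocks of
size `(p - 1)/2`: the index `i` in block `s` is in position `s (p - 1)/2 + i`. -/
def blockPosition (p : ℕ) (hp : Odd p) : Fin ((p - 1) / 2) × Fin 2 ≃ Fin (p - 1) :=
  ((Equiv.prodComm _ _).trans finProdFinEquiv).trans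
    (finCongr (by obtain ⟨m, rfl⟩ := hp; omega))

end Reordered

end SL2Tensor

/-! The multiplicities are computed by a truncated Clebsch-Gordan rule (`FusionRule`), and every
claim about the graph is then elementary arithmetic. The rule says that `V_j` occurs in `V_i ⊗ V_n`,
and then exactly once, if and only if `i + j + n` is odd and `|i - n| < j < min (i + n, 2p - i -
n)`.

Multiplicities are replaced by an additive invariant, which makes the Krull-Schmidt theorem
unnecessary. When the endomorphisms of `V` are scalars, the homomorphisms `M → V` modulo those
killed by composition with every `V → M` have dimension 1 for `M ≅ V` and 0 for any other
indecomposable `M`. This dimension is additive on direct sums, so it counts the summands isomorphic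
to `V` (`multiplicity_eq_stableRank`). It applies to `V_j` with `j ≤ p`, whose endomorphisms are
scalars by a highest weight argument (`hasScalarEnd_vRep`).

Explicit equivariant maps split `V_i ⊗ V_2` as `V_{i+1} ⊕ V_{i-1}` when `i ≥ 2` is nonzero in `k`
(`splittingTensorTwo`). Decomposing `V_i ⊗ V_2 ⊗ V_n` in two ways gives a recursion in `n`
(`fusionRank_recursion`). The truncation comes from the boundary `i = p`. There all endomorphisms of
`V_p` have trace zero, a property inherited by `V_p ⊗ V_n`, whereas `dim V_j ≠ 0` in `k` for `j <
p`; so `V_j` is not a summand (`fusionRank_prime`).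

For the graph, the parity condition separates or alternates odd and even vertices, and the rule is
invariant under `(i, j) ↦ (p - i, p - j)`, a reflection that exchanges the parities. For `1 < n < p
- 1` the vertices `i` and `i + 2` have a common neighbour, so vertices of equal parity are connected
(`reachable_add_two`). -/

namespace SL2Tensor

/-! ### Multiplicities and the radical of the composition pairing -/

/-! ### Existence of decompositions into indecomposables -/

section Decompositions

variable {R : Type*} [Ring R] {M : Type*} [AddCommGroup M] [Module R M]

/-- Indecomposability of a submodule, in terms of the lattice of submodules. -/
def IsIndecomposableSubmodule (N : Submodule R M) : Prop :=
  N ≠ ⊥ ∧ ∀ A B : Submodule R M, Disjoint A B → A ⊔ B = N → A = ⊥ ∨ B = ⊥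

theorem IsIndecomposableSubmodule.isIndecomposable {N : Submodule R M}
    (hN : IsIndecomposableSubmodule N) : IsIndecomposable R N := by
  refine ⟨Submodule.nontrivial_iff_ne_bot.2 hN.1, fun A B hAB => ?_⟩
  have hinj : Function.Injective (Submodule.map N.subtype) :=
    Submodule.map_injective_of_injective N.injective_subtype
  have h := hN.2 (A.map N.subtype) (B.map N.subtype)
    (Submodule.disjoint_map N.injective_subtype hAB.disjoint)
    (by rw [← Submodule.map_sup, hAB.sup_eq_top, Submodule.map_top, Submodule.range_subtype])
  refine h.imp (fun h => hinj ?_) (fun h => hinj ?_) <;> rw [h, Submodule.map_bot]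

/-- Every submodule of an artinian module is a finite independent sum of indecomposables. -/
theorem exists_finset_indecomposable [IsArtinian R M] (P : Submodule R M) :
    ∃ S : Finset (Submodule R M), S.SupIndep id ∧ S.sup id = P ∧
      ∀ N ∈ S, IsIndecomposableSubmodule N := by
  classical
  induction P using IsArtinian.induction with
  | hgt P ih =>
    by_cases h0 : P = ⊥
    · exact ⟨∅, Finset.supIndep_empty _, by simp [h0], by simp⟩
    by_cases hP : IsIndecomposableSubmodule P
    · exact ⟨{P}, Finset.supIndep_singleton _ _, by simp, by simpa using hP⟩
    · obtain ⟨A, B, hd, hs, hA, hB⟩ : ∃ A B : Submodule R M, Disjoint A B ∧ A ⊔ B = P ∧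
          A ≠ ⊥ ∧ B ≠ ⊥ := by
        by_contra hcon
        push Not at hcon
        exact hP ⟨h0, fun A B hd hs => or_iff_not_imp_left.2 (hcon A B hd hs)⟩
      have hAP : A < P := by
        refine lt_of_le_of_ne (hs ▸ le_sup_left) fun h => hB ?_
        have hBA : B ≤ A := by rw [h, ← hs]; exact le_sup_right
        exact hd.symm.eq_bot_of_le hBA
      have hBP : B < P := by
        refine lt_of_le_of_ne (hs ▸ le_sup_right) fun h => hA ?_
        have hAB : A ≤ B := by rw [h, ← hs]; exact le_sup_left
        exact hd.eq_bot_of_le hAB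
      obtain ⟨S, hS, hSA, hSi⟩ := ih A hAP
      obtain ⟨T, hT, hTB, hTi⟩ := ih B hBP
      refine ⟨S ∪ T, hS.union hT (by rwa [hSA, hTB]), by rw [Finset.sup_union, hSA, hTB, hs], ?_⟩
      intro N hN
      rcases Finset.mem_union.1 hN with h | h
      exacts [hSi N h, hTi N h]

theorem exists_hasDecompositionWith [IsArtinian R M] (V : Type*) [AddCommGroup V] [Module R V] :
    ∃ m, HasDecompositionWith R V M m := by
  obtain ⟨S, hS, hsup, hi⟩ := exists_finset_indecomposable (⊤ : Submodule R M)
  let e : Fin S.card ≃ S := S.equivFin.symm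
  refine ⟨_, S.card, fun t => (e t : Submodule R M), ?_,
    fun t => (hi _ (e t).2).isIndecomposable, rfl⟩
  rw [DirectSum.isInternal_submodule_iff_iSupIndep_and_iSup_eq_top]
  constructor
  · exact (Finset.SupIndep.independent hS).comp e.injective
  · rw [e.iSup_comp (g := fun N : S => (N : Submodule R M)), ← hsup, Finset.sup_eq_iSup,
      iSup_subtype]
    rfl

end Decompositions

/-! ### An additive invariant that counts summands -/

section Radical

variable (k R : Type*) [Field k] [Ring R] [Algebra k R]
variable (V : Type*) [AddCommGroup V] [Module k V] [Module R V] [IsScalarTower k R V]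

/-- The homomorphisms `M → V` all of whose composites with homomorphisms `V → M` vanish. -/
def radical (M : Type*) [AddCommGroup M] [Module R M] : Submodule k (M →ₗ[R] V) where
  carrier := {α | ∀ β : V →ₗ[R] M, α ∘ₗ β = 0}
  add_mem' ha hb β := by rw [LinearMap.add_comp, ha β, hb β, add_zero]
  zero_mem' β := LinearMap.zero_comp β
  smul_mem' c α ha β := by rw [LinearMap.smul_comp, ha β, smul_zero]

/-- The dimension of `Hom(M, V)` modulo the radical. -/
noncomputable def stableRank (M : Type*) [AddCommGroup M] [Module R M] : ℕ :=
  Module.finrank k ((M →ₗ[R] V) ⧸ radical k R V M)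

theorem finite_hom [FiniteDimensional k V] (M : Type*) [AddCommGroup M] [Module R M] [Module k M]
    [IsScalarTower k R M] [FiniteDimensional k M] : FiniteDimensional k (M →ₗ[R] V) := by
  let f : (M →ₗ[R] V) →ₗ[k] (M →ₗ[k] V) :=
    { toFun := fun α => α.restrictScalars k
      map_add' := fun _ _ => rfl
      map_smul' := fun _ _ => rfl }
  exact FiniteDimensional.of_injective f fun a b h => by
    ext x; exact LinearMap.congr_fun h x

section Additivity

variable {ι : Type*} [Fintype ι] {M : Type*} [AddCommGroup M] [Module R M]
  {N : ι → Type*} [∀ t, AddCommGroup (N t)] [∀ t, Module R (N t)]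
  (inj : ∀ t, N t →ₗ[R] M) (proj : ∀ t, M →ₗ[R] N t)

/-- Homomorphisms out of a direct sum. -/
def homEquivPi (hself : ∀ t, proj t ∘ₗ inj t = LinearMap.id)
    (hne : ∀ s t, s ≠ t → proj s ∘ₗ inj t = 0)
    (hsum : ∑ t, inj t ∘ₗ proj t = LinearMap.id) :
    (M →ₗ[R] V) ≃ₗ[k] ∀ t, N t →ₗ[R] V where
  toFun α t := α ∘ₗ inj t
  map_add' _ _ := rfl
  map_smul' _ _ := rfl
  invFun a := ∑ t, a t ∘ₗ proj t
  left_inv α := by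
    ext x
    have h := congrArg α (LinearMap.congr_fun hsum x)
    simpa using h
  right_inv a := by
    funext t
    ext x
    simp only [LinearMap.comp_apply, LinearMap.sum_apply]
    rw [Finset.sum_eq_single t]
    · exact congrArg (a t) (LinearMap.congr_fun (hself t) x)
    · intro s _ hst
      have h := LinearMap.congr_fun (hne s t hst) x
      rw [LinearMap.comp_apply] at h
      rw [h]; simp
    · simp

/-- The radical is compatible with the sum: a map `V → N t` becomes a map `V → M` through `inj t`,
and a map `V → M` is the sum of its components through the `proj t`. Hence `α` is radical exactly
when each of its restrictions is. -/
theorem stableRank_eq_sum [∀ t, FiniteDimensional k (N t →ₗ[R] V)]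
    (hself : ∀ t, proj t ∘ₗ inj t = LinearMap.id)
    (hne : ∀ s t, s ≠ t → proj s ∘ₗ inj t = 0)
    (hsum : ∑ t, inj t ∘ₗ proj t = LinearMap.id) :
    stableRank k R V M = ∑ t, stableRank k R V (N t) := by
  classical
  let e := homEquivPi k R V inj proj hself hne hsum
  have he : (radical k R V M).map (e : (M →ₗ[R] V) →ₗ[k] ∀ t, N t →ₗ[R] V) =
      Submodule.pi Set.univ fun t => radical k R V (N t) := by
    ext a
    rw [Submodule.mem_map_equiv, Submodule.mem_pi]
    constructor
    · intro h t _ β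
      have h1 := h (inj t ∘ₗ β)
      have h2 : e (e.symm a) t = a t := by rw [e.apply_symm_apply]
      rw [← h2]
      exact h1
    · intro h β
      have h1 : (e.symm a) ∘ₗ β = ∑ t, a t ∘ₗ (proj t ∘ₗ β) := by
        ext x
        simp [e, homEquivPi]
      rw [h1]
      exact Finset.sum_eq_zero fun t _ => h t (Set.mem_univ t) _
  have e2 := Submodule.Quotient.equiv (radical k R V M) _ e he
  rw [stableRank, (e2.trans (Submodule.quotientPi _)).finrank_eq, Module.finrank_pi_fintype]
  rfl

end Additivity

variable {k R V} in
/-- If the endomorphisms of `V` are scalars, then an indecomposable module outside the isomorphism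
class of `V` has stable rank zero. -/
theorem radical_eq_top_of_not_iso (hV : ∀ f : V →ₗ[R] V, ∃ c : k, ∀ v, f v = c • v)
    {M : Type*} [AddCommGroup M] [Module R M] (hM : IsIndecomposable R M)
    (h : ¬ Nonempty (M ≃ₗ[R] V)) : radical k R V M = ⊤ := by
  rw [eq_top_iff]
  intro α _ β
  obtain ⟨c, hc⟩ := hV (α ∘ₗ β)
  by_cases hc0 : c = 0
  · ext v
    rw [hc, hc0, zero_smul]
    rfl
  -- For `c ≠ 0` the map `c⁻¹ • β ∘ α` is an idempotent, with image the range of `β` and kernel that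
  -- of `α`. Indecomposability then leaves only `β = 0` or `α` bijective.
  have hcompl : IsCompl (LinearMap.range β) (LinearMap.ker α) := by
    constructor
    · rw [Submodule.disjoint_def]
      rintro _ ⟨v, rfl⟩ hv
      have h1 := hc v
      rw [LinearMap.comp_apply, LinearMap.mem_ker.1 hv] at h1
      rw [(smul_eq_zero.1 h1.symm).resolve_left hc0, map_zero]
    · rw [codisjoint_iff, eq_top_iff]
      intro x _
      have h1 : α (β (c⁻¹ • α x)) = α x := by
        have := hc (c⁻¹ • α x)
        rwa [smul_smul, mul_inv_cancel₀ hc0, one_smul] at this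
      rw [← add_sub_cancel (β (c⁻¹ • α x)) x]
      exact Submodule.add_mem_sup ⟨_, rfl⟩ (by rw [LinearMap.mem_ker, map_sub, h1, sub_self])
  have hsurj : Function.Surjective α := fun v => ⟨β (c⁻¹ • v), by
    have := hc (c⁻¹ • v)
    rwa [smul_smul, mul_inv_cancel₀ hc0, one_smul] at this⟩
  rcases hM.2 _ _ hcompl with h1 | h1
  · rw [LinearMap.range_eq_bot.1 h1, LinearMap.comp_zero]
  · exact absurd ⟨LinearEquiv.ofBijective α ⟨LinearMap.ker_eq_bot.1 h1, hsurj⟩⟩ h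

theorem stableRank_eq_zero_iff (M : Type*) [AddCommGroup M] [Module R M]
    [FiniteDimensional k (M →ₗ[R] V)] : stableRank k R V M = 0 ↔ radical k R V M = ⊤ := by
  rw [stableRank, Module.finrank_zero_iff, Submodule.Quotient.subsingleton_iff]

theorem stableRank_congr {M N : Type*} [AddCommGroup M] [Module R M] [AddCommGroup N] [Module R N]
    [FiniteDimensional k (N →ₗ[R] V)] (e : M ≃ₗ[R] N) : stableRank k R V M = stableRank k R V N := by
  rw [stableRank_eq_sum k R V (ι := Unit) (N := fun _ => N) (fun _ => e.symm.toLinearMap)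
    (fun _ => e.toLinearMap) (fun _ => by ext; simp) (fun s t h => absurd rfl h) (by ext; simp)]
  simp

variable {k R V} in
theorem stableRank_self (hV : ∀ f : V →ₗ[R] V, ∃ c : k, ∀ v, f v = c • v) [Nontrivial V] :
    stableRank k R V V = 1 := by
  -- Testing against `β = id` shows that nothing but zero is radical.
  have hbot : radical k R V V = ⊥ := by
    rw [eq_bot_iff]
    intro α hα
    exact hα LinearMap.id
  have e : k ≃ₗ[k] (V →ₗ[R] V) :=
    LinearEquiv.ofBijective (LinearMap.toSpanSingleton k (V →ₗ[R] V) LinearMap.id) (by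
      constructor
      · rw [← LinearMap.ker_eq_bot, LinearMap.ker_eq_bot']
        intro c hc
        obtain ⟨v, hv⟩ := exists_ne (0 : V)
        exact (smul_eq_zero.1 (LinearMap.congr_fun hc v)).resolve_right hv
      · intro f
        obtain ⟨c, hc⟩ := hV f
        exact ⟨c, by ext v; simp [hc]⟩)
  rw [stableRank, hbot, ((Submodule.quotEquivOfEqBot ⊥ rfl).trans e.symm).finrank_eq,
    Module.finrank_self]

variable {k R V} in
/-- The number of summands isomorphic to `V` in any decomposition into indecomposables. -/
theorem HasDecompositionWith.eq_stableRank [FiniteDimensional k V] [Nontrivial V]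
    (hV : ∀ f : V →ₗ[R] V, ∃ c : k, ∀ v, f v = c • v)
    {M : Type*} [AddCommGroup M] [Module R M] [Module k M] [IsScalarTower k R M]
    [FiniteDimensional k M] {m : ℕ} (h : HasDecompositionWith R V M m) :
    m = stableRank k R V M := by
  classical
  obtain ⟨s, N, hN, hi, rfl⟩ := h
  have hfin : ∀ t, FiniteDimensional k (N t) := fun t =>
    FiniteDimensional.of_injective ((N t).subtype.restrictScalars k) Subtype.val_injective
  have hfin' : ∀ t, FiniteDimensional k (N t →ₗ[R] V) := fun t => finite_hom k R V (N t)
  let e := LinearEquiv.ofBijective (DirectSum.coeLinearMap N) hN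
  have hsymm : ∀ t (x : N t), e.symm x = DirectSum.lof R (Fin s) (fun t => N t) t x := by
    intro t x
    rw [LinearEquiv.symm_apply_eq]
    exact (DirectSum.coeLinearMap_lof N t x).symm
  rw [stableRank_eq_sum k R V (fun t => (N t).subtype)
    (fun t => DirectSum.component R (Fin s) (fun t => N t) t ∘ₗ e.symm.toLinearMap)]
  · have hterm : ∀ t, stableRank k R V (N t) = if Nonempty (N t ≃ₗ[R] V) then 1 else 0 := by
      intro t
      split_ifs with ht
      · obtain ⟨f⟩ := ht
        have : FiniteDimensional k (V →ₗ[R] V) := finite_hom k R V V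
        rw [stableRank_congr k R V f, stableRank_self hV]
      · exact (stableRank_eq_zero_iff k R V _).2 (radical_eq_top_of_not_iso hV (hi t) ht)
    simp_rw [hterm]
    rw [Finset.sum_boole, Nat.card_eq_fintype_card, Fintype.card_subtype]
    rfl
  · intro t
    ext x
    simp [hsymm, DirectSum.component.lof_self]
  · intro a b hab
    ext x
    simp [hsymm, DirectSum.component.of, hab.symm]
  · ext x
    obtain ⟨y, rfl⟩ := e.surjective x
    simp only [LinearMap.sum_apply, LinearMap.comp_apply, LinearEquiv.coe_coe,
      LinearEquiv.symm_apply_apply, LinearMap.id_apply, Submodule.subtype_apply]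
    change _ = DirectSum.coeLinearMap N y
    rw [DirectSum.coeLinearMap_eq_dfinsuppSum, DFinsupp.sum_eq_sum_fintype]
    · rfl
    · intros; rfl

-- The set in the definition of `multiplicity` is a singleton: it is nonempty because
-- finite-dimensional modules are artinian, and all its members equal the stable rank.
variable {k R V} in
theorem multiplicity_eq_stableRank [FiniteDimensional k V] [Nontrivial V]
    (hV : ∀ f : V →ₗ[R] V, ∃ c : k, ∀ v, f v = c • v)
    (M : Type*) [AddCommGroup M] [Module R M] [Module k M] [IsScalarTower k R M]
    [FiniteDimensional k M] : multiplicity R V M = stableRank k R V M := by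
  have : IsArtinian R M := isArtinian_of_tower k inferInstance
  obtain ⟨m, hm⟩ := exists_hasDecompositionWith (R := R) (M := M) V
  have hset : {m : ℕ | HasDecompositionWith R V M m} = {stableRank k R V M} := by
    ext l
    refine ⟨fun hl => hl.eq_stableRank hV, ?_⟩
    rintro rfl
    rwa [← hm.eq_stableRank hV]
  rw [multiplicity, hset, csSup_singleton]

end Radical
end SL2Tensor

namespace SL2Tensor

/-! ### Split sums and traces of representations -/

open Representation

section Splittings

variable {k Γ : Type*} [Field k] [Group Γ]

/-- A decomposition of a representation as a finite direct sum. -/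
structure Splitting {ι : Type*} [Fintype ι] {X : ι → Type*} [∀ t, AddCommGroup (X t)]
    [∀ t, Module k (X t)] {Y : Type*} [AddCommGroup Y] [Module k Y]
    (σ : Representation k Γ Y) (ρ : ∀ t, Representation k Γ (X t)) where
  /-- The inclusion of a summand. -/
  inj : ∀ t, IntertwiningMap (ρ t) σ
  /-- The projection to a summand. -/
  proj : ∀ t, IntertwiningMap σ (ρ t)
  proj_inj_self : ∀ t, (proj t).toLinearMap ∘ₗ (inj t).toLinearMap = LinearMap.id
  proj_inj_ne : ∀ s t, s ≠ t → (proj s).toLinearMap ∘ₗ (inj t).toLinearMap = 0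
  sum_inj_proj : ∑ t, (inj t).toLinearMap ∘ₗ (proj t).toLinearMap = LinearMap.id

/-- The stable rank of representations. -/
noncomputable def repRank {Y W : Type*} [AddCommGroup Y] [Module k Y] [AddCommGroup W] [Module k W]
    (σ : Representation k Γ Y) (τ : Representation k Γ W) : ℕ :=
  stableRank k (MonoidAlgebra k Γ) τ.asModule σ.asModule

variable {ι : Type*} [Fintype ι] {X : ι → Type*} [∀ t, AddCommGroup (X t)]
    [∀ t, Module k (X t)] {Y W : Type*} [AddCommGroup Y] [Module k Y]
    [AddCommGroup W] [Module k W]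
    {σ : Representation k Γ Y} {ρ : ∀ t, Representation k Γ (X t)}

theorem Splitting.repRank_eq_sum (S : Splitting σ ρ) (τ : Representation k Γ W)
    [FiniteDimensional k W] [∀ t, FiniteDimensional k (X t)] :
    repRank σ τ = ∑ t, repRank (ρ t) τ := by
  have : ∀ t, FiniteDimensional k ((ρ t).asModule →ₗ[MonoidAlgebra k Γ] τ.asModule) :=
    fun t => finite_hom k _ _ _
  refine stableRank_eq_sum k (MonoidAlgebra k Γ) τ.asModule
    (fun t => IntertwiningMap.equivLinearMapAsModule _ _ (S.inj t))
    (fun t => IntertwiningMap.equivLinearMapAsModule _ _ (S.proj t)) ?_ ?_ ?_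
  · intro t
    ext x
    exact LinearMap.congr_fun (S.proj_inj_self t) x
  · intro s t h
    ext x
    exact LinearMap.congr_fun (S.proj_inj_ne s t h) x
  · ext x
    have h : ∀ y : Y, ∑ t, S.inj t (S.proj t y) = y := fun y => by
      simpa using! LinearMap.congr_fun S.sum_inj_proj y
    exact (LinearMap.sum_apply _ _ _).trans (h x)

/-- Tensoring a splitting with a representation. -/
noncomputable def Splitting.tensorRight (S : Splitting σ ρ) (τ : Representation k Γ W) :
    Splitting (σ.tprod τ) (fun t => (ρ t).tprod τ) where
  inj t := (S.inj t).rTensor τ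
  proj t := (S.proj t).rTensor τ
  proj_inj_self t := by
    rw [IntertwiningMap.toLinearMap_rTensor, IntertwiningMap.toLinearMap_rTensor,
      ← LinearMap.rTensor_comp, S.proj_inj_self, LinearMap.rTensor_id]
  proj_inj_ne s t h := by
    rw [IntertwiningMap.toLinearMap_rTensor, IntertwiningMap.toLinearMap_rTensor,
      ← LinearMap.rTensor_comp, S.proj_inj_ne s t h, LinearMap.rTensor_zero]
  sum_inj_proj := by
    simp only [IntertwiningMap.toLinearMap_rTensor, ← LinearMap.rTensor_comp]
    have h := congrArg (LinearMap.rTensorHom (R := k) W) S.sum_inj_proj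
    rw [map_sum] at h
    exact h.trans (LinearMap.rTensor_id _ _)

/-- Stable ranks are invariant under isomorphism. -/
theorem repRank_congr {Z : Type*} [AddCommGroup Z] [Module k Z] {σ' : Representation k Γ Z}
    (e : Y ≃ₗ[k] Z) (he : ∀ g, e.toLinearMap ∘ₗ σ g = σ' g ∘ₗ e.toLinearMap)
    (τ : Representation k Γ W) [FiniteDimensional k W] [FiniteDimensional k Z] :
    repRank σ τ = repRank σ' τ := by
  let E : Representation.Equiv σ σ' := Representation.Equiv.mk e he
  let S : Splitting σ (fun _ : Unit => σ') :=
    { inj := fun _ => E.symm.toIntertwiningMap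
      proj := fun _ => E.toIntertwiningMap
      proj_inj_self := fun _ => by ext x; exact e.apply_symm_apply x
      proj_inj_ne := fun s t h => absurd rfl h
      sum_inj_proj := by
        ext x
        simp only [Finset.univ_unique, Finset.sum_singleton]
        exact e.symm_apply_apply x }
  rw [S.repRank_eq_sum τ]
  simp

theorem repRank_tprod_comm {Z : Type*} [AddCommGroup Z] [Module k Z] (σ : Representation k Γ Y)
    (σ' : Representation k Γ Z) (τ : Representation k Γ W) [FiniteDimensional k W]
    [FiniteDimensional k Y] [FiniteDimensional k Z] :
    repRank (σ.tprod σ') τ = repRank (σ'.tprod σ) τ :=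
  repRank_congr (TensorProduct.comm k Y Z) (fun g => by ext; simp) τ

/-- With `V_2` as the middle factor, the reversal lets it be absorbed by either outer factor. -/
theorem repRank_tprod_reverse {Z U : Type*} [AddCommGroup Z] [Module k Z] [AddCommGroup U]
    [Module k U] (σ : Representation k Γ Y) (σ' : Representation k Γ Z)
    (σ'' : Representation k Γ U) (τ : Representation k Γ W) [FiniteDimensional k W]
    [FiniteDimensional k Y] [FiniteDimensional k Z] [FiniteDimensional k U] :
    repRank ((σ.tprod σ').tprod σ'') τ = repRank ((σ''.tprod σ').tprod σ) τ := by
  refine repRank_congr ((TensorProduct.comm k _ _).trans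
    ((TensorProduct.congr (LinearEquiv.refl k U) (TensorProduct.comm k Y Z)).trans
      (TensorProduct.assoc k U Z Y).symm)) (fun g => ?_) τ
  refine TensorProduct.ext_threefold fun x y z => ?_
  simp

/-! ### Negligible representations and representations with scalar endomorphisms -/

/-- A representation is negligible if all of its endomorphisms have trace zero. -/
def Negligible (σ : Representation k Γ Y) : Prop :=
  ∀ f : Y →ₗ[k] Y, (∀ g, f ∘ₗ σ g = σ g ∘ₗ f) → LinearMap.trace k Y f = 0

/-- The partial trace of endomorphisms of a tensor product. -/
theorem exists_partialTrace [FiniteDimensional k Y] [FiniteDimensional k W] :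
    ∃ P : (TensorProduct k Y W →ₗ[k] TensorProduct k Y W) →ₗ[k] (Y →ₗ[k] Y),
      (∀ f h, P (TensorProduct.map f h) = LinearMap.trace k W h • f) := by
  refine ⟨(TensorProduct.rid k (Y →ₗ[k] Y)).toLinearMap ∘ₗ
    (LinearMap.lTensor (Y →ₗ[k] Y) (LinearMap.trace k W)) ∘ₗ
    (homTensorHomEquiv k Y W Y W).symm.toLinearMap, fun f h => ?_⟩
  have : (homTensorHomEquiv k Y W Y W).symm (TensorProduct.map f h) = f ⊗ₜ[k] h := by
    rw [LinearEquiv.symm_apply_eq, homTensorHomEquiv_apply, TensorProduct.homTensorHomMap_apply]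
  simp [this]

/-- In finite dimension `End (Y ⊗ W) = End Y ⊗ End W`, so additive identities need only be checked
on the maps `f ⊗ h`. -/
theorem endomorphism_induction [FiniteDimensional k Y] [FiniteDimensional k W]
    {motive : (TensorProduct k Y W →ₗ[k] TensorProduct k Y W) → Prop}
    (hmap : ∀ f h, motive (TensorProduct.map f h)) (hadd : ∀ a b, motive a → motive b →
      motive (a + b)) (F : TensorProduct k Y W →ₗ[k] TensorProduct k Y W) : motive F := by
  obtain ⟨z, rfl⟩ := (homTensorHomEquiv k Y W Y W).surjective F
  induction z with
  | zero => rw [map_zero, ← TensorProduct.map_zero_left (0 : W →ₗ[k] W)]; exact hmap _ _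
  | tmul f h =>
    rw [homTensorHomEquiv_apply, TensorProduct.homTensorHomMap_apply]; exact hmap f h
  | add a b ha hb => rw [map_add]; exact hadd _ _ ha hb

/-- The partial trace over `W` preserves the total trace and carries conjugation by `σ g ⊗ τ g` to
conjugation by `σ g`. It therefore sends equivariant endomorphisms of `Y ⊗ W` to equivariant
endomorphisms of `Y`, which have trace zero. -/
theorem Negligible.tprod [FiniteDimensional k Y] [FiniteDimensional k W]
    (hσ : Negligible σ) (τ : Representation k Γ W) : Negligible (σ.tprod τ) := by
  intro F hF
  obtain ⟨P, hP⟩ := exists_partialTrace (k := k) (Y := Y) (W := W)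
  have htr : ∀ F, LinearMap.trace k (TensorProduct k Y W) F = LinearMap.trace k Y (P F) := by
    intro F
    induction F using endomorphism_induction with
    | hmap f h => rw [LinearMap.trace_tensorProduct', hP, map_smul, smul_eq_mul, mul_comm]
    | hadd a b ha hb => rw [map_add, map_add, map_add, ha, hb]
  have hconj : ∀ g F, P ((σ.tprod τ) g ∘ₗ F ∘ₗ (σ.tprod τ) g⁻¹) = σ g ∘ₗ P F ∘ₗ σ g⁻¹ := by
    intro g F
    induction F using endomorphism_induction with
    | hmap f h =>
      rw [Representation.tprod_apply, Representation.tprod_apply, ← TensorProduct.map_comp,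
        ← TensorProduct.map_comp, hP, hP,
        LinearMap.trace_comp_comm', LinearMap.comp_assoc,
        ← Module.End.mul_eq_comp (τ g⁻¹), ← map_mul, inv_mul_cancel, map_one,
        Module.End.one_eq_id, LinearMap.comp_id, LinearMap.smul_comp, LinearMap.comp_smul]
    | hadd a b ha hb =>
      simp only [LinearMap.add_comp, LinearMap.comp_add, map_add, ha, hb]
  rw [htr]
  apply hσ
  intro g
  have h1 := hconj g F
  rw [← LinearMap.comp_assoc, ← hF g, LinearMap.comp_assoc, ← Module.End.mul_eq_comp,
    ← Module.End.mul_eq_comp, ← map_mul, mul_inv_cancel, map_one, mul_one] at h1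
  conv_lhs => rw [h1]
  rw [LinearMap.comp_assoc, LinearMap.comp_assoc, ← Module.End.mul_eq_comp (σ g⁻¹), ← map_mul,
    inv_mul_cancel, map_one, Module.End.one_eq_id, LinearMap.comp_id]

/-- All endomorphisms of the representation are scalars. -/
def HasScalarEnd (τ : Representation k Γ W) : Prop :=
  ∀ f : W →ₗ[k] W, (∀ g, f ∘ₗ τ g = τ g ∘ₗ f) → ∃ c : k, ∀ v, f v = c • v

theorem HasScalarEnd.asModule {τ : Representation k Γ W} (hτ : HasScalarEnd τ)
    (f : τ.asModule →ₗ[MonoidAlgebra k Γ] τ.asModule) : ∃ c : k, ∀ v, f v = c • v := by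
  obtain ⟨F, rfl⟩ := (IntertwiningMap.equivLinearMapAsModule τ τ).surjective f
  exact hτ F.toLinearMap F.isIntertwining'

/-- If `a ∘ b = c • id` on `W`, then `c * dim W = tr (a ∘ b) = tr (b ∘ a) = 0`, and `dim W` is
invertible in `k`. -/
theorem Negligible.repRank_eq_zero [FiniteDimensional k Y] [FiniteDimensional k W]
    (hσ : Negligible σ) {τ : Representation k Γ W} (hτ : HasScalarEnd τ)
    (hW : (Module.finrank k W : k) ≠ 0) : repRank σ τ = 0 := by
  have := finite_hom k (MonoidAlgebra k Γ) τ.asModule σ.asModule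
  refine (stableRank_eq_zero_iff k (MonoidAlgebra k Γ) τ.asModule σ.asModule).2 ?_
  rw [eq_top_iff]
  intro α _ β
  obtain ⟨a, rfl⟩ := (IntertwiningMap.equivLinearMapAsModule σ τ).surjective α
  obtain ⟨b, rfl⟩ := (IntertwiningMap.equivLinearMapAsModule τ σ).surjective β
  obtain ⟨c, hc⟩ := hτ (a.comp b).toLinearMap (a.comp b).isIntertwining'
  have h1 := hσ (b.comp a).toLinearMap (b.comp a).isIntertwining'
  rw [IntertwiningMap.comp_toLinearMap, LinearMap.trace_comp_comm',
    ← IntertwiningMap.comp_toLinearMap] at h1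
  have h2 : (a.comp b).toLinearMap = c • LinearMap.id := by
    ext v
    exact hc v
  rw [h2, map_smul, LinearMap.trace_id, smul_eq_mul] at h1
  have h3 := (mul_eq_zero.1 h1).resolve_right hW
  ext v
  refine (hc v).trans ?_
  rw [h3]
  exact zero_smul k (show W from v)

theorem HasScalarEnd.negligible [FiniteDimensional k Y] (hσ : HasScalarEnd σ)
    (hY : (Module.finrank k Y : k) = 0) : Negligible σ := by
  intro f hf
  obtain ⟨c, hc⟩ := hσ f hf
  have h2 : f = c • LinearMap.id := by
    ext v
    exact hc v
  rw [h2, map_smul, LinearMap.trace_id, hY, smul_zero]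

theorem HasScalarEnd.repRank_self [Nontrivial W] {τ : Representation k Γ W}
    (hτ : HasScalarEnd τ) : repRank τ τ = 1 := by
  have : Nontrivial τ.asModule := inferInstanceAs (Nontrivial W)
  exact stableRank_self hτ.asModule

/-- Representations with scalar endomorphisms of different dimension have stable rank zero. -/
theorem HasScalarEnd.repRank_eq_zero [FiniteDimensional k Y] [FiniteDimensional k W]
    (hσ : HasScalarEnd σ) {τ : Representation k Γ W} (hτ : HasScalarEnd τ)
    (hd : Module.finrank k Y ≠ Module.finrank k W) : repRank σ τ = 0 := by
  have := finite_hom k (MonoidAlgebra k Γ) τ.asModule σ.asModule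
  refine (stableRank_eq_zero_iff k (MonoidAlgebra k Γ) τ.asModule σ.asModule).2 ?_
  rw [eq_top_iff]
  intro α _ β
  obtain ⟨a, rfl⟩ := (IntertwiningMap.equivLinearMapAsModule σ τ).surjective α
  obtain ⟨b, rfl⟩ := (IntertwiningMap.equivLinearMapAsModule τ σ).surjective β
  obtain ⟨c, hc⟩ := hτ (a.comp b).toLinearMap (a.comp b).isIntertwining'
  obtain ⟨d, hd'⟩ := hσ (b.comp a).toLinearMap (b.comp a).isIntertwining'
  replace hc : ∀ v, a (b v) = c • v := hc
  replace hd' : ∀ v, b (a v) = d • v := hd'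
  suffices h : ∀ v, a (b v) = 0 by
    ext v
    exact h v
  by_cases hc0 : c = 0
  · simpa [hc0] using hc
  by_cases hd0 : d = 0
  · intro v
    have h1 : a (b (a (b v))) = 0 := by rw [hd', hd0, zero_smul, map_zero]
    rw [hc, smul_eq_zero] at h1
    exact h1.resolve_left hc0
  -- With both scalars nonzero, `a` and `b` are injective, which forces equal dimensions.
  · refine absurd ?_ hd
    refine le_antisymm (LinearMap.finrank_le_finrank_of_injective (f := a.toLinearMap) ?_)
      (LinearMap.finrank_le_finrank_of_injective (f := b.toLinearMap) ?_)
    · rw [← LinearMap.ker_eq_bot, LinearMap.ker_eq_bot']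
      intro v hv
      replace hv : a v = 0 := hv
      have := hd' v
      rw [hv, map_zero] at this
      exact (smul_eq_zero.1 this.symm).resolve_left hd0
    · rw [← LinearMap.ker_eq_bot, LinearMap.ker_eq_bot']
      intro v hv
      replace hv : b v = 0 := hv
      have := hc v
      rw [hv, map_zero] at this
      exact (smul_eq_zero.1 this.symm).resolve_left hc0

theorem HasScalarEnd.multiplicity_eq_repRank [FiniteDimensional k Y] [FiniteDimensional k W]
    [Nontrivial W] {τ : Representation k Γ W} (hτ : HasScalarEnd τ) (σ : Representation k Γ Y) :
    multiplicity (MonoidAlgebra k Γ) τ.asModule σ.asModule = repRank σ τ := by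
  have : Nontrivial τ.asModule := inferInstanceAs (Nontrivial W)
  exact multiplicity_eq_stableRank (k := k) hτ.asModule σ.asModule

end Splittings

end SL2Tensor

namespace SL2Tensor

/-! ### The spaces `V_n` -/

open Representation

section Spaces

variable {k : Type*} [Field k]

/-- The polynomial underlying an element of `V_n`. -/
noncomputable def toPoly (n : ℕ) : V k n →ₗ[k] MvPolynomial (Fin 2) k :=
  (homogeneousSubmodule (Fin 2) k (n - 1)).subtype

theorem toPoly_injective (n : ℕ) : Function.Injective (toPoly (k := k) n) :=
  Submodule.injective_subtype _

theorem toPoly_isHomogeneous (n : ℕ) (f : V k n) : (toPoly n f).IsHomogeneous (n - 1) := f.2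

/-- A homogeneous polynomial as an element of `V_n`. -/
def ofPoly (n : ℕ) (f : MvPolynomial (Fin 2) k) (hf : f.IsHomogeneous (n - 1)) : V k n := ⟨f, hf⟩

@[simp]
theorem toPoly_ofPoly (n : ℕ) (f : MvPolynomial (Fin 2) k) (hf : f.IsHomogeneous (n - 1)) :
    toPoly n (ofPoly n f hf) = f := rfl

theorem V_ext {n : ℕ} {f g : V k n} (h : toPoly n f = toPoly n g) : f = g :=
  toPoly_injective n h

/-- The monomial `X^(n-1-u) Y^u` of `V_n`. -/
noncomputable def mono (n : ℕ) (u : Fin n) : V k n :=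
  ofPoly n (X 0 ^ (n - 1 - u) * X 1 ^ (u : ℕ)) (by
    have h := (isHomogeneous_X_pow (R := k) (0 : Fin 2) (n - 1 - u)).mul
      (isHomogeneous_X_pow (R := k) (1 : Fin 2) u)
    rwa [Nat.sub_add_cancel (by have := u.2; omega)] at h)

@[simp]
theorem toPoly_mono (n : ℕ) (u : Fin n) :
    toPoly n (mono (k := k) n u) = X 0 ^ (n - 1 - u) * X 1 ^ (u : ℕ) := rfl

theorem exists_eq_sum_mono (n : ℕ) [NeZero n] (f : V k n) :
    ∃ c : Fin n → k, f = ∑ u, c u • mono n u := by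
  have key : ∀ F ∈ homogeneousSubmodule (Fin 2) k (n - 1),
      ∃ c : Fin n → k, F = ∑ u, c u • toPoly n (mono n u) := by
    intro F hF
    rw [homogeneousSubmodule_eq_finsupp_supported, AddMonoidAlgebra.supported_eq_span_single] at hF
    induction hF using Submodule.span_induction with
    | mem x hx =>
      obtain ⟨m, hm, rfl⟩ := hx
      have hm' : m 0 + m 1 = n - 1 := by
        have : m.degree = n - 1 := hm
        rwa [Finsupp.degree_eq_sum, Fin.sum_univ_two] at this
      have hn := NeZero.pos n
      refine ⟨Pi.single ⟨m 1, by omega⟩ 1, ?_⟩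
      rw [Finset.sum_eq_single ⟨m 1, by omega⟩]
      · have h0 : n - 1 - m 1 = m 0 := by omega
        change monomial m 1 = _
        rw [Pi.single_eq_same, one_smul, toPoly_mono, monomial_eq,
          Finsupp.prod_fintype _ _ (fun _ => pow_zero _), Fin.prod_univ_two]
        simp [h0]
      · intro b _ hb
        rw [Pi.single_eq_of_ne hb, zero_smul]
      · simp
    | zero => exact ⟨0, by simp⟩
    | add x y _ _ hx hy =>
      obtain ⟨c, rfl⟩ := hx
      obtain ⟨d, rfl⟩ := hy
      exact ⟨c + d, by simp [add_smul, Finset.sum_add_distrib]⟩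
    | smul a x _ hx =>
      obtain ⟨c, rfl⟩ := hx
      exact ⟨a • c, by simp [Finset.smul_sum, smul_smul]⟩
  obtain ⟨c, hc⟩ := key (toPoly n f) (toPoly_isHomogeneous n f)
  exact ⟨c, V_ext (by rw [hc]; simp)⟩

/-- The dehomogenization `f ↦ f(1, Y)`. -/
noncomputable def dehomogenize (n : ℕ) : V k n →ₗ[k] Polynomial k :=
  (aeval ![1, Polynomial.X] : MvPolynomial (Fin 2) k →ₐ[k] Polynomial k).toLinearMap ∘ₗ toPoly n

theorem dehomogenize_mono (n : ℕ) (u : Fin n) :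
    dehomogenize n (mono (k := k) n u) = Polynomial.X ^ (u : ℕ) := by
  simp [dehomogenize]

theorem coeff_sum_smul_X_pow {n : ℕ} (c : Fin n → k) (u : Fin n) :
    (∑ v, c v • (Polynomial.X : Polynomial k) ^ (v : ℕ)).coeff u = c u := by
  rw [Polynomial.finsetSum_coeff, Finset.sum_eq_single u]
  · simp
  · intro b _ hb
    rw [Polynomial.coeff_smul, Polynomial.coeff_X_pow, if_neg (fun h => hb (Fin.ext h.symm)),
      smul_zero]
  · simp

theorem dehomogenize_sum {n : ℕ} (c : Fin n → k) :
    dehomogenize n (∑ u, c u • mono n u) = ∑ v, c v • (Polynomial.X : Polynomial k) ^ (v : ℕ) := by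
  simp only [map_sum, map_smul, dehomogenize_mono]

theorem natDegree_sum_smul_X_pow_lt {n : ℕ} [NeZero n] (c : Fin n → k) :
    (∑ v, c v • (Polynomial.X : Polynomial k) ^ (v : ℕ)).natDegree < n := by
  refine lt_of_le_of_lt (Polynomial.natDegree_sum_le_of_forall_le (n := n - 1) _ _ ?_)
    (Nat.sub_lt (NeZero.pos n) one_pos)
  intro v _
  refine (Polynomial.natDegree_smul_le _ _).trans ?_
  rw [Polynomial.natDegree_X_pow]
  have := v.2
  omega

/-- The basis of monomials of `V_n`. -/
noncomputable def monoBasis (n : ℕ) [NeZero n] : Module.Basis (Fin n) k (V k n) :=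
  Module.Basis.mk (v := mono n) (by
    rw [Fintype.linearIndependent_iff]
    intro c hc u
    -- Setting `X = 1` turns the monomials into distinct powers of one variable.
    have h := congrArg (dehomogenize n) hc
    rw [dehomogenize_sum, map_zero] at h
    rw [← coeff_sum_smul_X_pow c u, h, Polynomial.coeff_zero]) (by
    intro f _
    obtain ⟨c, rfl⟩ := exists_eq_sum_mono n f
    exact Submodule.sum_mem _ fun u _ =>
      Submodule.smul_mem _ _ (Submodule.subset_span ⟨u, rfl⟩))

instance (n : ℕ) [NeZero n] : FiniteDimensional k (V k n) :=
  (monoBasis n).finiteDimensional_of_finite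

theorem finrank_V (n : ℕ) [NeZero n] : Module.finrank k (V k n) = n := by
  rw [Module.finrank_eq_card_basis (monoBasis n), Fintype.card_fin]

instance (n : ℕ) [NeZero n] : Nontrivial (V k n) :=
  Module.nontrivial_of_finrank_pos (R := k) (by rw [finrank_V]; exact NeZero.pos n)

end Spaces

/-! ### Unitriangular matrices and the endomorphisms of `V_n` for `n ≤ p` -/

section Action

variable {k : Type*} [Field k] {p : ℕ} [CharP k p]

theorem toPoly_vRep (n : ℕ) (g : G p) (f : V k n) :
    toPoly n (vRep k p n g f) = substitution k p g (toPoly n f) := rfl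

theorem substitution_X_zero (g : G p) : substitution k p g (X 0) =
    C (entry k p g 0 0) * X 0 + C (entry k p g 1 0) * X 1 := by
  simp [substitution, images]

theorem substitution_X_one (g : G p) : substitution k p g (X 1) =
    C (entry k p g 0 1) * X 0 + C (entry k p g 1 1) * X 1 := by
  simp [substitution, images]

theorem entry_det (g : G p) :
    entry k p g 0 0 * entry k p g 1 1 - entry k p g 0 1 * entry k p g 1 0 = 1 := by
  have h := g.det_coe
  rw [Matrix.det_fin_two] at h
  simpa [entry] using congrArg (ZMod.castHom (dvd_refl p) k) h

/-- The matrix `(1 t; 0 1)`. -/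
def upper (t : ZMod p) : G p := ⟨!![1, t; 0, 1], by simp⟩

/-- The matrix `(1 0; t 1)`. -/
def lower (t : ZMod p) : G p := ⟨!![1, 0; t, 1], by simp⟩


theorem vRep_upper_mono_zero (m : ℕ) (t : ZMod p) :
    vRep k p (m + 1) (upper t) (mono (m + 1) 0) = mono (m + 1) 0 := by
  apply V_ext
  rw [toPoly_vRep, toPoly_mono, map_mul, map_pow, map_pow, substitution_X_zero]
  simp [entry, upper]

theorem vRep_lower_mono_zero (m : ℕ) (t : ZMod p) :
    vRep k p (m + 1) (lower t) (mono (m + 1) 0) =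
      ∑ u : Fin (m + 1), ((m.choose u : k) * ZMod.castHom (dvd_refl p) k t ^ (u : ℕ)) •
        mono (m + 1) u := by
  apply V_ext
  rw [toPoly_vRep, toPoly_mono, map_mul, map_pow, map_pow, substitution_X_zero, map_sum]
  simp only [map_smul, toPoly_mono, entry, lower, Matrix.of_apply, Matrix.cons_val_zero,
    Matrix.cons_val_one, Fin.val_zero, pow_zero, mul_one, map_one, one_mul, Nat.sub_zero,
    Nat.add_sub_cancel, Matrix.SpecialLinearGroup.coe_mk, Matrix.cons_val', Matrix.cons_val_fin_one]
  rw [add_comm, add_pow, Finset.sum_range]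
  refine Finset.sum_congr rfl fun u _ => ?_
  rw [smul_eq_C_mul, C_mul, C_pow, mul_pow, ← map_natCast (C : k →+* MvPolynomial (Fin 2) k)]
  ring

variable [Fact p.Prime]

theorem polynomial_eq_zero_of_forall_zmod {q : Polynomial k} (hq : q.natDegree < p)
    (h : ∀ t : ZMod p, q.eval (ZMod.castHom (dvd_refl p) k t) = 0) : q = 0 :=
  Polynomial.eq_zero_of_natDegree_lt_card_of_eval_eq_zero q
    (ZMod.castHom (dvd_refl p) k).injective h (by rwa [ZMod.card])

/-- A vector of `V_n` fixed by the upper unitriangular matrices is a multiple of `X^(n-1)`. -/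
theorem exists_eq_smul_mono_zero {m : ℕ} (hm : m < p) {h : V k (m + 1)}
    (hh : ∀ t : ZMod p, vRep k p (m + 1) (upper t) h = h) : ∃ c : k, h = c • mono (m + 1) 0 := by
  obtain ⟨c, hc⟩ := exists_eq_sum_mono (m + 1) h
  -- The matrix `upper t` fixes `X` and sends `Y` to `tX + Y`, so the transform of `h` takes at `(1,
  -- 0)` the value `h(1, t)`. Invariance makes `h(1, t)` independent of `t`.
  have heval : ∀ t : ZMod p, (dehomogenize (m + 1) h).eval (ZMod.castHom (dvd_refl p) k t) =
      eval ![1, 0] (toPoly (m + 1) h) := by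
    intro t
    conv_rhs => rw [← hh t, toPoly_vRep]
    have h1 : ((Polynomial.aeval (ZMod.castHom (dvd_refl p) k t) : Polynomial k →ₐ[k] k).comp
        (aeval ![1, Polynomial.X])) =
        (aeval ![1, 0] : MvPolynomial (Fin 2) k →ₐ[k] k).comp (substitution k p (upper t)) := by
      ext j
      fin_cases j <;> simp [substitution, images, entry, upper]
    exact DFunLike.congr_fun h1 (toPoly (m + 1) h)
  -- This polynomial has degree less than `p` and vanishes on the `p` elements of the prime field.
  have hd : dehomogenize (m + 1) h - Polynomial.C (eval ![1, 0] (toPoly (m + 1) h)) = 0 := by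
    refine polynomial_eq_zero_of_forall_zmod (p := p) ?_ fun t => by
      rw [Polynomial.eval_sub, heval t, Polynomial.eval_C, sub_self]
    rw [Polynomial.natDegree_sub_C, hc, dehomogenize_sum]
    exact (natDegree_sum_smul_X_pow_lt c).trans_le hm
  refine ⟨c 0, ?_⟩
  rw [hc, Finset.sum_eq_single 0]
  · intro u _ hu
    have h2 := congrArg (fun q => Polynomial.coeff q (u : ℕ)) (sub_eq_zero.1 hd)
    have hu' : (u : ℕ) ≠ 0 := fun h => hu (Fin.ext h)
    simp only [Polynomial.coeff_C, if_neg hu'] at h2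
    rw [hc, dehomogenize_sum, coeff_sum_smul_X_pow] at h2
    rw [h2, zero_smul]
  · simp

theorem choose_cast_ne_zero {m : ℕ} (hm : m < p) (u : Fin (m + 1)) : (m.choose u : k) ≠ 0 := by
  have hp : p.Prime := Fact.out
  rw [Ne, CharP.cast_eq_zero_iff k p]
  intro h
  have h1 : p ∣ m.factorial := by
    rw [← Nat.choose_mul_factorial_mul_factorial (Nat.lt_succ_iff.1 u.2)]
    exact Dvd.dvd.mul_right (Dvd.dvd.mul_right h _) _
  exact absurd ((hp.dvd_factorial).1 h1) (by omega)

/-- The vector `X^(n-1)` generates `V_n` over the lower unitriangular matrices. -/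
theorem eq_zero_of_lower_mono_zero {m : ℕ} (hm : m < p) {W : Type*} [AddCommGroup W] [Module k W]
    (ψ : V k (m + 1) →ₗ[k] W)
    (hψ : ∀ t : ZMod p, ψ (vRep k p (m + 1) (lower t) (mono (m + 1) 0)) = 0) : ψ = 0 := by
  refine (monoBasis (m + 1)).ext fun u => ?_
  rw [monoBasis, Module.Basis.mk_apply, LinearMap.zero_apply,
    ← Module.forall_dual_apply_eq_zero_iff k]
  intro l
  -- Applying `l ∘ ψ` to `(X + tY)^m` gives a polynomial in `t` with coefficients `d`. It has degree
  -- less than `p` and vanishes on the prime field, so every `d v` is zero, and the binomial factor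
  -- is invertible since `m < p`.
  let d : Fin (m + 1) → k := fun v => (m.choose v : k) * l (ψ (mono (m + 1) v))
  have hq : ∑ v, d v • (Polynomial.X : Polynomial k) ^ (v : ℕ) = 0 := by
    refine polynomial_eq_zero_of_forall_zmod (p := p)
      ((natDegree_sum_smul_X_pow_lt d).trans_le hm) fun t => ?_
    have h := congrArg l (hψ t)
    rw [vRep_lower_mono_zero, map_sum, map_sum, map_zero] at h
    rw [Polynomial.eval_finsetSum, ← h]
    refine Finset.sum_congr rfl fun v _ => ?_
    rw [map_smul, map_smul, Polynomial.eval_smul, Polynomial.eval_pow, Polynomial.eval_X,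
      smul_eq_mul, smul_eq_mul]
    ring
  have h := coeff_sum_smul_X_pow d u
  rw [hq, Polynomial.coeff_zero] at h
  exact (mul_eq_zero.1 h.symm).resolve_left (choose_cast_ne_zero hm u)

/-- An endomorphism sends the highest weight vector `X^m` to a vector fixed by the upper
unitriangular matrices, hence to a multiple `c X^m`. Since the translates of `X^m` under the lower
ones span, it is `c` everywhere. The bound `m < p` includes the module `V_p`. -/
theorem hasScalarEnd_vRep {m : ℕ} (hm : m < p) : HasScalarEnd (vRep k p (m + 1)) := by
  intro φ hφ
  obtain ⟨c, hc⟩ := exists_eq_smul_mono_zero (k := k) (p := p) (m := m) hm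
    (h := φ (mono (m + 1) 0)) (fun t => by
      have h := LinearMap.congr_fun (hφ (upper t)) (mono (m + 1) 0)
      rw [LinearMap.comp_apply, LinearMap.comp_apply, vRep_upper_mono_zero] at h
      exact h.symm)
  refine ⟨c, ?_⟩
  have h0 : φ - LinearMap.lsmul k _ c = 0 := by
    refine eq_zero_of_lower_mono_zero (p := p) hm _ fun t => ?_
    have h := LinearMap.congr_fun (hφ (lower t)) (mono (m + 1) 0)
    rw [LinearMap.comp_apply, LinearMap.comp_apply, hc, map_smul] at h
    rw [LinearMap.sub_apply, LinearMap.lsmul_apply, h, sub_self]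
  intro v
  rw [sub_eq_zero.1 h0, LinearMap.lsmul_apply]

end Action
end SL2Tensor

namespace SL2Tensor

/-! ### The decomposition of `V_n ⊗ V_2` -/

open Representation TensorProduct

section Maps

variable {k : Type*} [Field k]

/-- The variable `X_i`, as an element of `V_2`. -/
noncomputable def varTwo (i : Fin 2) : V k 2 := ofPoly 2 (X i) (isHomogeneous_X k i)

@[simp]
theorem toPoly_varTwo (i : Fin 2) : toPoly (k := k) 2 (varTwo i) = X i := rfl

/-- Multiplication by a linear form. -/
noncomputable def mulLin (m : ℕ) : V k (m + 1) →ₗ[k] V k 2 →ₗ[k] V k (m + 2) :=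
  LinearMap.mk₂ k (fun f l => ofPoly (m + 2) (toPoly _ f * toPoly _ l)
      ((toPoly_isHomogeneous _ f).mul (toPoly_isHomogeneous _ l)))
    (fun f f' l => V_ext (by simp [add_mul])) (fun c f l => V_ext (by simp))
    (fun f l l' => V_ext (by simp [mul_add])) (fun c f l => V_ext (by simp))

@[simp]
theorem toPoly_mulLin (m : ℕ) (f : V k (m + 1)) (l : V k 2) :
    toPoly (m + 2) (mulLin m f l) = toPoly _ f * toPoly _ l := rfl

/-- Partial derivatives. -/
noncomputable def partialDeriv (m : ℕ) (i : Fin 2) : V k (m + 2) →ₗ[k] V k (m + 1) where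
  toFun f := ofPoly (m + 1) (pderiv i (toPoly _ f)) (toPoly_isHomogeneous _ f).pderiv
  map_add' f g := V_ext (by simp)
  map_smul' c f := V_ext (by simp)

@[simp]
theorem toPoly_partialDeriv (m : ℕ) (i : Fin 2) (f : V k (m + 2)) :
    toPoly (m + 1) (partialDeriv m i f) = pderiv i (toPoly _ f) := rfl

/-- The Jacobian determinant. -/
noncomputable def jacobian (m : ℕ) : V k (m + 2) →ₗ[k] V k 2 →ₗ[k] V k (m + 1) :=
  LinearMap.mk₂ k (fun f l => ofPoly (m + 1)
      (pderiv 0 (toPoly _ f) * pderiv 1 (toPoly _ l) -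
        pderiv 1 (toPoly _ f) * pderiv 0 (toPoly _ l))
      (((toPoly_isHomogeneous _ f).pderiv.mul (toPoly_isHomogeneous _ l).pderiv).sub
        ((toPoly_isHomogeneous _ f).pderiv.mul (toPoly_isHomogeneous _ l).pderiv)))
    (fun f f' l => V_ext (by simp; ring)) (fun c f l => V_ext (by simp [smul_sub]))
    (fun f l l' => V_ext (by simp; ring)) (fun c f l => V_ext (by simp [smul_sub]))

@[simp]
theorem toPoly_jacobian (m : ℕ) (f : V k (m + 2)) (l : V k 2) :
    toPoly (m + 1) (jacobian m f l) = pderiv 0 (toPoly _ f) * pderiv 1 (toPoly _ l) -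
        pderiv 1 (toPoly _ f) * pderiv 0 (toPoly _ l) := rfl

/-- The gradient `f ↦ ∂f/∂X ⊗ X + ∂f/∂Y ⊗ Y`. -/
noncomputable def gradient (m : ℕ) : V k (m + 2) →ₗ[k] V k (m + 1) ⊗[k] V k 2 :=
  (TensorProduct.mk k _ _).flip (varTwo 0) ∘ₗ partialDeriv m 0 +
    (TensorProduct.mk k _ _).flip (varTwo 1) ∘ₗ partialDeriv m 1

theorem gradient_apply (m : ℕ) (f : V k (m + 2)) : gradient m f =
    partialDeriv m 0 f ⊗ₜ varTwo 0 + partialDeriv m 1 f ⊗ₜ varTwo 1 := rfl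

/-- The map `f ↦ fX ⊗ Y - fY ⊗ X`. -/
noncomputable def wedge (m : ℕ) : V k (m + 1) →ₗ[k] V k (m + 2) ⊗[k] V k 2 :=
  (TensorProduct.mk k _ _).flip (varTwo 1) ∘ₗ (mulLin m).flip (varTwo 0) -
    (TensorProduct.mk k _ _).flip (varTwo 0) ∘ₗ (mulLin m).flip (varTwo 1)

theorem wedge_apply (m : ℕ) (f : V k (m + 1)) : wedge m f =
    mulLin m f (varTwo 0) ⊗ₜ varTwo 1 - mulLin m f (varTwo 1) ⊗ₜ varTwo 0 := rfl

theorem exists_eq_varTwo (l : V k 2) : ∃ a b : k, l = a • varTwo 0 + b • varTwo 1 := by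
  obtain ⟨c, hc⟩ := exists_eq_sum_mono 2 l
  refine ⟨c 0, c 1, ?_⟩
  have h0 : mono (k := k) 2 0 = varTwo 0 := V_ext (by simp)
  have h1 : mono (k := k) 2 1 = varTwo 1 := V_ext (by simp)
  rw [hc, Fin.sum_univ_two, h0, h1]

theorem euler (m : ℕ) (f : V k (m + 1)) :
    X 0 * pderiv 0 (toPoly _ f) + X 1 * pderiv 1 (toPoly _ f) = (m : k) • toPoly _ f := by
  have h := (toPoly_isHomogeneous _ f).sum_X_mul_pderiv
  rw [Fin.sum_univ_two] at h
  rw [h, Nat.cast_smul_eq_nsmul]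
  rfl

theorem mulLin_gradient (m : ℕ) :
    TensorProduct.lift (mulLin m) ∘ₗ gradient m =
      ((m + 1 : ℕ) : k) • (LinearMap.id : V k (m + 2) →ₗ[k] _) := by
  ext f
  apply V_ext
  rw [LinearMap.comp_apply, LinearMap.smul_apply, LinearMap.id_apply, gradient_apply, map_add,
    TensorProduct.lift.tmul, TensorProduct.lift.tmul, map_add, map_smul, ← euler (m + 1) f]
  simp only [toPoly_mulLin, toPoly_partialDeriv, toPoly_varTwo]
  ring

theorem jacobian_gradient (m : ℕ) :
    TensorProduct.lift (jacobian (k := k) m) ∘ₗ gradient (m + 1) = 0 := by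
  ext f
  apply V_ext
  rw [LinearMap.comp_apply, LinearMap.zero_apply, gradient_apply, map_add,
    TensorProduct.lift.tmul, TensorProduct.lift.tmul, map_add]
  simp only [toPoly_jacobian, toPoly_partialDeriv, toPoly_varTwo, pderiv_X_self, map_zero,
    pderiv_X_of_ne (zero_ne_one' (Fin 2)), pderiv_X_of_ne (zero_ne_one' (Fin 2)).symm]
  have h : pderiv 0 (pderiv 1 (toPoly (m + 3) f)) = pderiv 1 (pderiv 0 (toPoly (m + 3) f)) := by
    -- Mixed partials commute: the commutator is a derivation that vanishes on both variables.
    have h0 : ⁅pderiv (R := k) (0 : Fin 2), pderiv (R := k) (1 : Fin 2)⁆ = 0 :=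
      MvPolynomial.derivation_ext fun i => by
        fin_cases i <;> simp [Derivation.commutator_apply]
    have h1 := congrArg (fun d => d (toPoly (m + 3) f)) h0
    rw [Derivation.commutator_apply] at h1
    exact sub_eq_zero.1 h1
  rw [h]
  ring

theorem mulLin_wedge (m : ℕ) :
    TensorProduct.lift (mulLin (k := k) (m + 1)) ∘ₗ wedge m = 0 := by
  ext f
  apply V_ext
  rw [LinearMap.comp_apply, LinearMap.zero_apply, wedge_apply, map_sub,
    TensorProduct.lift.tmul, TensorProduct.lift.tmul, map_sub]
  simp only [toPoly_mulLin, toPoly_varTwo, map_zero]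
  ring

theorem jacobian_wedge (m : ℕ) :
    TensorProduct.lift (jacobian m) ∘ₗ wedge m =
      ((m + 2 : ℕ) : k) • (LinearMap.id : V k (m + 1) →ₗ[k] _) := by
  ext f
  apply V_ext
  have he := euler m f
  rw [LinearMap.comp_apply, LinearMap.smul_apply, LinearMap.id_apply, wedge_apply, map_sub,
    TensorProduct.lift.tmul, TensorProduct.lift.tmul, map_sub, map_smul]
  simp only [toPoly_jacobian, toPoly_mulLin, toPoly_varTwo, pderiv_X_self, pderiv_mul,
    pderiv_X_of_ne (zero_ne_one' (Fin 2)), pderiv_X_of_ne (zero_ne_one' (Fin 2)).symm]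
  rw [Nat.cast_add, add_smul, ← he, Nat.cast_smul_eq_nsmul]
  ring

/-- On `f ⊗ X_i` the product rule yields `f ⊗ X_i` together with derivative terms. Those with second
factor the other variable cancel against `wedge`, and the rest add up to `(m + 1) f ⊗ X_i` by
Euler's identity. -/
theorem gradient_mulLin_add_wedge_jacobian (m : ℕ) :
    gradient (m + 1) ∘ₗ TensorProduct.lift (mulLin (m + 1)) +
      wedge m ∘ₗ TensorProduct.lift (jacobian m) =
    ((m + 2 : ℕ) : k) • (LinearMap.id : V k (m + 2) ⊗[k] V k 2 →ₗ[k] _) := by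
  refine TensorProduct.ext' fun f l => ?_
  have h0 : ∀ i, partialDeriv (m + 1) i (mulLin (m + 1) f (varTwo i)) =
      f + mulLin m (partialDeriv m i f) (varTwo i) := fun i => V_ext (by
    simp only [toPoly_partialDeriv, toPoly_mulLin, toPoly_varTwo, pderiv_mul, pderiv_X_self,
      map_add]
    ring)
  have h1 : ∀ i j, j ≠ i → partialDeriv (m + 1) i (mulLin (m + 1) f (varTwo j)) =
      mulLin m (partialDeriv m i f) (varTwo j) := fun i j hij => V_ext (by
    simp only [toPoly_partialDeriv, toPoly_mulLin, toPoly_varTwo, pderiv_mul, pderiv_X_of_ne hij]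
    ring)
  have h2 : jacobian m f (varTwo 0) = - partialDeriv m 1 f := V_ext (by
    simp only [toPoly_partialDeriv, toPoly_jacobian, toPoly_varTwo, pderiv_X_self, map_neg,
      pderiv_X_of_ne (zero_ne_one' (Fin 2))]
    ring)
  have h3 : jacobian m f (varTwo 1) = partialDeriv m 0 f := V_ext (by
    simp only [toPoly_partialDeriv, toPoly_jacobian, toPoly_varTwo, pderiv_X_self,
      pderiv_X_of_ne (zero_ne_one' (Fin 2)).symm]
    ring)
  have he : mulLin m (partialDeriv m 0 f) (varTwo 0) + mulLin m (partialDeriv m 1 f) (varTwo 1) =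
      ((m + 1 : ℕ) : k) • f := V_ext (by
    rw [map_smul, ← euler (m + 1) f]
    simp only [map_add, toPoly_mulLin, toPoly_partialDeriv, toPoly_varTwo]
    ring)
  have hcast : ((m + 2 : ℕ) : k) • f = f + ((m + 1 : ℕ) : k) • f := by
    push_cast
    module
  have hx : ∀ i, gradient (m + 1) (mulLin (m + 1) f (varTwo i)) +
      wedge m (jacobian m f (varTwo i)) = (((m + 2 : ℕ) : k) • f) ⊗ₜ varTwo i := by
    intro i
    rw [hcast, ← he]
    fin_cases i
    · simp only [Fin.zero_eta]
      rw [gradient_apply, wedge_apply, h0, h1 1 0 (by decide), h2]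
      simp only [TensorProduct.add_tmul, map_neg, LinearMap.neg_apply, TensorProduct.neg_tmul]
      abel
    · simp only [Fin.mk_one]
      rw [gradient_apply, wedge_apply, h0, h1 0 1 (by decide), h3]
      simp only [TensorProduct.add_tmul]
      abel
  obtain ⟨a, b, rfl⟩ := exists_eq_varTwo l
  simp only [LinearMap.add_apply, LinearMap.comp_apply, TensorProduct.lift.tmul,
    LinearMap.smul_apply, LinearMap.id_apply, map_add, map_smul, TensorProduct.tmul_add,
    TensorProduct.tmul_smul, smul_add]
  have hx' : ∀ i, ((m + 2 : ℕ) : k) • f ⊗ₜ[k] varTwo i = gradient (m + 1)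
      (mulLin (m + 1) f (varTwo i)) + wedge m (jacobian m f (varTwo i)) := fun i =>
    (TensorProduct.smul_tmul' _ _ _).trans (hx i).symm
  rw [hx' 0, hx' 1, smul_add, smul_add]

end Maps

/-! ### Equivariance of the maps and the resulting splitting -/

section Equivariance

variable {k : Type*} [Field k] {p : ℕ} [CharP k p]

/-- The chain rule for linear substitutions. -/
theorem pderiv_substitution (g : G p) (i : Fin 2) (f : MvPolynomial (Fin 2) k) :
    pderiv i (substitution k p g f) =
      C (entry k p g i 0) * substitution k p g (pderiv 0 f) +
        C (entry k p g i 1) * substitution k p g (pderiv 1 f) := by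
  induction f using MvPolynomial.induction_on with
  | C a =>
    have h : substitution k p g (C a) = C a := (substitution k p g).commutes a
    rw [h]
    simp
  | add f f' hf hf' => simp only [map_add, hf, hf']; ring
  | mul_X f j hf =>
    have hX : pderiv i (substitution k p g (X j)) = C (entry k p g i j) := by
      fin_cases j <;> fin_cases i <;>
        simp [substitution_X_zero, substitution_X_one]
    rw [map_mul, pderiv_mul, hf, hX, pderiv_mul, pderiv_mul, map_add, map_mul, map_mul, map_add,
      map_mul, map_mul]
    fin_cases j
    · simp only [Fin.zero_eta, pderiv_X_self, pderiv_X_of_ne (zero_ne_one' (Fin 2)), map_one,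
        map_zero]
      ring
    · simp only [Fin.mk_one, pderiv_X_self, pderiv_X_of_ne (zero_ne_one' (Fin 2)).symm, map_one,
        map_zero]
      ring

theorem vRep_varTwo (g : G p) (j : Fin 2) : vRep k p 2 g (varTwo j) =
    entry k p g 0 j • varTwo 0 + entry k p g 1 j • varTwo 1 := by
  apply V_ext
  rw [toPoly_vRep, map_add, map_smul, map_smul]
  simp only [toPoly_varTwo, smul_eq_C_mul]
  fin_cases j
  exacts [substitution_X_zero g, substitution_X_one g]

/-- Multiplication as an intertwining map. -/
noncomputable def mulMap (m : ℕ) :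
    IntertwiningMap ((vRep k p (m + 1)).tprod (vRep k p 2)) (vRep k p (m + 2)) where
  toLinearMap := TensorProduct.lift (mulLin m)
  isIntertwining' g := TensorProduct.ext' fun f l => V_ext (by
    simp only [LinearMap.comp_apply, Representation.tprod_apply, TensorProduct.map_tmul,
      TensorProduct.lift.tmul, toPoly_vRep, toPoly_mulLin, map_mul])

/-- The Jacobian determinant as an intertwining map. -/
noncomputable def jacobianMap (m : ℕ) :
    IntertwiningMap ((vRep k p (m + 2)).tprod (vRep k p 2)) (vRep k p (m + 1)) where
  toLinearMap := TensorProduct.lift (jacobian m)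
  isIntertwining' g := TensorProduct.ext' fun f l => V_ext (by
    simp only [LinearMap.comp_apply, Representation.tprod_apply, TensorProduct.map_tmul,
      TensorProduct.lift.tmul, toPoly_vRep, toPoly_jacobian, map_mul, map_sub,
      pderiv_substitution]
    -- A linear substitution multiplies the Jacobian by its determinant, which is 1 here.
    have h := congrArg (C : k → MvPolynomial (Fin 2) k) (entry_det (k := k) g)
    simp only [map_sub, map_mul, map_one] at h
    linear_combination (substitution k p g (pderiv 0 (toPoly _ f)) *
      substitution k p g (pderiv 1 (toPoly _ l)) - substitution k p g (pderiv 1 (toPoly _ f)) *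
      substitution k p g (pderiv 0 (toPoly _ l))) * h)

theorem partialDeriv_vRep (m : ℕ) (g : G p) (i : Fin 2) (f : V k (m + 2)) :
    partialDeriv m i (vRep k p (m + 2) g f) =
      entry k p g i 0 • vRep k p (m + 1) g (partialDeriv m 0 f) +
        entry k p g i 1 • vRep k p (m + 1) g (partialDeriv m 1 f) := V_ext (by
  simp only [toPoly_partialDeriv, toPoly_vRep, map_add, map_smul, pderiv_substitution,
    smul_eq_C_mul])

/-- The gradient as an intertwining map. -/
noncomputable def gradientMap (m : ℕ) :
    IntertwiningMap (vRep k p (m + 2)) ((vRep k p (m + 1)).tprod (vRep k p 2)) where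
  toLinearMap := gradient m
  isIntertwining' g := by
    ext f
    simp only [LinearMap.comp_apply, gradient_apply, Representation.tprod_apply, map_add,
      TensorProduct.map_tmul, partialDeriv_vRep, vRep_varTwo, TensorProduct.add_tmul,
      TensorProduct.tmul_add, TensorProduct.tmul_smul, TensorProduct.smul_tmul']
    abel

theorem mulLin_vRep (m : ℕ) (g : G p) (f : V k (m + 1)) (l : V k 2) :
    mulLin m (vRep k p (m + 1) g f) (vRep k p 2 g l) = vRep k p (m + 2) g (mulLin m f l) :=
  V_ext (by simp only [toPoly_mulLin, toPoly_vRep, map_mul])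

/-- The map `f ↦ fX ⊗ Y - fY ⊗ X` as an intertwining map. -/
noncomputable def wedgeMap (m : ℕ) :
    IntertwiningMap (vRep k p (m + 1)) ((vRep k p (m + 2)).tprod (vRep k p 2)) where
  toLinearMap := wedge m
  isIntertwining' g := by
    ext f
    simp only [LinearMap.comp_apply, wedge_apply, Representation.tprod_apply, map_sub,
      TensorProduct.map_tmul, ← mulLin_vRep, vRep_varTwo, map_add, map_smul,
      TensorProduct.add_tmul, TensorProduct.tmul_add, TensorProduct.tmul_smul,
      ← TensorProduct.smul_tmul', smul_add, smul_smul]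
    -- Equivariance amounts to the invariance of `X ⊗ Y - Y ⊗ X`, again because the determinant is
    -- 1.
    have h := entry_det (k := k) g
    have h' : entry k p g 0 0 * entry k p g 1 1 = 1 + entry k p g 0 1 * entry k p g 1 0 := by
      linear_combination h
    rw [mul_comm (entry k p g 1 1) (entry k p g 0 0), h', mul_comm (entry k p g 1 0)]
    module

/-- The summands `V_{n+1}` and `V_{n-1}` of `V_n ⊗ V_2`. -/
noncomputable def splittingTensorTwo (m : ℕ) (hm : ((m + 2 : ℕ) : k) ≠ 0) :
    Splitting ((vRep k p (m + 2)).tprod (vRep k p 2))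
      (fun b : Bool => vRep k p (bif b then m + 3 else m + 1)) where
  inj
    -- Both unnormalised composites, on `V_{m+3}` and on `V_{m+1}`, are multiplication by the same
    -- scalar `m + 2`, so one inverse normalises both inclusions.
    | true => ((m + 2 : ℕ) : k)⁻¹ • gradientMap (m + 1)
    | false => ((m + 2 : ℕ) : k)⁻¹ • wedgeMap m
  proj
    | true => mulMap (m + 1)
    | false => jacobianMap m
  proj_inj_self
    | true => by
      change TensorProduct.lift (mulLin (m + 1)) ∘ₗ (((m + 2 : ℕ) : k)⁻¹ • gradient (m + 1)) =
        LinearMap.id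
      rw [LinearMap.comp_smul, mulLin_gradient (m + 1), inv_smul_smul₀ hm]
    | false => by
      change TensorProduct.lift (jacobian m) ∘ₗ (((m + 2 : ℕ) : k)⁻¹ • wedge m) = LinearMap.id
      rw [LinearMap.comp_smul, jacobian_wedge, inv_smul_smul₀ hm]
  proj_inj_ne
    | true, true, h => absurd rfl h
    | false, false, h => absurd rfl h
    | true, false, _ => by
      change TensorProduct.lift (mulLin (m + 1)) ∘ₗ (((m + 2 : ℕ) : k)⁻¹ • wedge m) = 0
      rw [LinearMap.comp_smul, mulLin_wedge, smul_zero]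
    | false, true, _ => by
      change TensorProduct.lift (jacobian m) ∘ₗ (((m + 2 : ℕ) : k)⁻¹ • gradient (m + 1)) = 0
      rw [LinearMap.comp_smul, jacobian_gradient, smul_zero]
  sum_inj_proj := by
    rw [Fintype.sum_bool]
    change (((m + 2 : ℕ) : k)⁻¹ • gradient (m + 1)) ∘ₗ TensorProduct.lift (mulLin (m + 1)) +
      (((m + 2 : ℕ) : k)⁻¹ • wedge m) ∘ₗ TensorProduct.lift (jacobian m) = LinearMap.id
    rw [LinearMap.smul_comp, LinearMap.smul_comp, ← smul_add, gradient_mulLin_add_wedge_jacobian,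
      inv_smul_smul₀ hm]

end Equivariance
end SL2Tensor

namespace SL2Tensor

/-! ### The fusion rule -/

open Representation TensorProduct

section Arithmetic

/-- The truncated Clebsch-Gordan rule. -/
def FusionRule (p n i j : ℕ) : Prop :=
  (i + j + n) % 2 = 1 ∧ i < j + n ∧ j < i + n ∧ n < i + j ∧ i + j + n < 2 * p

instance (p n i j : ℕ) : Decidable (FusionRule p n i j) := by
  unfold FusionRule; infer_instance

theorem FusionRule.two (p : ℕ) {i : ℕ} {j : ℕ} (hi : i + 2 < p) (hj : j < p) :
    ((if i + 3 = j then 1 else 0) + if i + 1 = j then 1 else 0 : ℕ) =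
      if FusionRule p 2 (i + 2) j then 1 else 0 := by
  split_ifs with h1 h2 h3 <;> unfold FusionRule at * <;> omega

theorem FusionRule.recursion (p n i j : ℕ) (hi : i + 2 < p) :
    (if FusionRule p (n + 3) (i + 2) j then 1 else 0 : ℕ) =
      ((if FusionRule p (n + 2) (i + 3) j then 1 else 0) +
        if FusionRule p (n + 2) (i + 1) j then 1 else 0) -
      if FusionRule p (n + 1) (i + 2) j then 1 else 0 := by
  split_ifs with h1 h2 h3 h4 <;> simp only [FusionRule] at * <;> omega

end Arithmetic

/-! ### Stable ranks of `V_i ⊗ V_n` -/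

section FusionRule

variable (k : Type*) [Field k] (p : ℕ) [CharP k p]

/-- The stable rank of `V_i ⊗ V_n` with respect to `V_j`. -/
noncomputable def fusionRank (i n j : ℕ) : ℕ :=
  repRank ((vRep k p i).tprod (vRep k p n)) (vRep k p j)

theorem fusionRank_comm (i n j : ℕ) [NeZero i] [NeZero n] [NeZero j] :
    fusionRank k p i n j = fusionRank k p n i j :=
  repRank_tprod_comm _ _ _

theorem repRank_splitting {m : ℕ} (hm : ((m + 2 : ℕ) : k) ≠ 0) (j : ℕ) [NeZero j] :
    repRank ((vRep k p (m + 2)).tprod (vRep k p 2)) (vRep k p j) =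
      repRank (vRep k p (m + 3)) (vRep k p j) + repRank (vRep k p (m + 1)) (vRep k p j) := by
  have : ∀ b : Bool, FiniteDimensional k (V k (bif b then m + 3 else m + 1)) := fun b => by
    cases b <;> simp only [cond_true, cond_false] <;> infer_instance
  rw [(splittingTensorTwo m hm).repRank_eq_sum (vRep k p j), Fintype.sum_bool]
  rfl

theorem repRank_splitting_tprod {m : ℕ} (hm : ((m + 2 : ℕ) : k) ≠ 0) (n j : ℕ) [NeZero n]
    [NeZero j] :
    repRank (((vRep k p (m + 2)).tprod (vRep k p 2)).tprod (vRep k p n)) (vRep k p j) =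
      fusionRank k p (m + 3) n j + fusionRank k p (m + 1) n j := by
  have : ∀ b : Bool, FiniteDimensional k (V k (bif b then m + 3 else m + 1)) := fun b => by
    cases b <;> simp only [cond_true, cond_false] <;> infer_instance
  rw [((splittingTensorTwo m hm).tensorRight (vRep k p n)).repRank_eq_sum (vRep k p j),
    Fintype.sum_bool]
  rfl

/-- Both sides are the stable rank of `V_{l+2} ⊗ V_2 ⊗ V_{m+2}`, with `V_2` absorbed by the left or
by the right factor. -/
theorem fusionRank_recursion {l m : ℕ} (hl : ((l + 2 : ℕ) : k) ≠ 0) (hm : ((m + 2 : ℕ) : k) ≠ 0)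
    (j : ℕ) [NeZero j] :
    fusionRank k p (l + 3) (m + 2) j + fusionRank k p (l + 1) (m + 2) j =
      fusionRank k p (l + 2) (m + 3) j + fusionRank k p (l + 2) (m + 1) j := by
  rw [← repRank_splitting_tprod k p hl, repRank_tprod_reverse, repRank_splitting_tprod k p hm,
    fusionRank_comm k p (m + 3), fusionRank_comm k p (m + 1)]

theorem fusionRank_one (i j : ℕ) [NeZero i] [NeZero j] :
    fusionRank k p i 1 j = repRank (vRep k p i) (vRep k p j) := by
  let e : k ≃ₗ[k] V k 1 :=
    (LinearEquiv.funUnique (Fin 1) k k).symm.trans (monoBasis 1).equivFun.symm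
  have he : e 1 = mono 1 0 := by
    simp [e, monoBasis, Module.Basis.equivFun_symm_apply]
  let E : V k i ≃ₗ[k] V k i ⊗[k] V k 1 :=
    (TensorProduct.rid k (V k i)).symm.trans (TensorProduct.congr (LinearEquiv.refl k _) e)
  have hE : ∀ f, E f = f ⊗ₜ mono 1 0 := fun f => by
    simp [E, he]
  refine (repRank_congr E (fun g => ?_) _).symm
  have hinv : vRep k p 1 g (mono 1 0) = mono 1 0 := by
    apply V_ext
    rw [toPoly_vRep]
    simp
  ext f
  simp only [LinearMap.comp_apply, LinearEquiv.coe_coe, hE, Representation.tprod_apply,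
    TensorProduct.map_tmul, hinv]

theorem natCast_ne_zero {n : ℕ} (h0 : 0 < n) (hn : n < p) : (n : k) ≠ 0 := by
  rw [Ne, CharP.cast_eq_zero_iff k p]
  exact Nat.not_dvd_of_pos_of_lt h0 hn

variable [Fact p.Prime]

theorem hasScalarEnd_vRep_of_le {n : ℕ} [NeZero n] (hn : n ≤ p) : HasScalarEnd (vRep k p n) := by
  obtain ⟨m, rfl⟩ : ∃ m, n = m + 1 := Nat.exists_eq_succ_of_ne_zero (NeZero.ne n)
  exact hasScalarEnd_vRep hn

theorem repRank_vRep {i j : ℕ} [NeZero i] [NeZero j] (hi : i ≤ p) (hj : j ≤ p) :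
    repRank (vRep k p i) (vRep k p j) = if i = j then 1 else 0 := by
  split_ifs with h
  · subst h
    exact (hasScalarEnd_vRep_of_le k p hi).repRank_self
  · exact (hasScalarEnd_vRep_of_le k p hi).repRank_eq_zero (hasScalarEnd_vRep_of_le k p hj)
      (by rwa [finrank_V, finrank_V])

/-- The dimension of `V_p` is zero in `k` and its endomorphisms are scalars, so `V_p` is negligible,
and so is `V_p ⊗ V_n`; but `dim V_j` is nonzero in `k`. -/
theorem fusionRank_prime (n : ℕ) [NeZero n] {j : ℕ} [NeZero j] (hj : j < p) :
    fusionRank k p p n j = 0 := by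
  have : NeZero p := ⟨(Fact.out : p.Prime).ne_zero⟩
  have h : Negligible (vRep k p p) := (hasScalarEnd_vRep_of_le k p le_rfl).negligible (by
    rw [finrank_V]; exact CharP.cast_eq_zero k p)
  refine (h.tprod (vRep k p n)).repRank_eq_zero (hasScalarEnd_vRep_of_le k p hj.le) ?_
  rw [finrank_V]
  exact natCast_ne_zero k p (NeZero.pos j) hj

/-- Induction on `n` through the recursion. The step for `i` uses the values at `i + 1`, which may
be `p`, so the range of the first index includes the boundary where the rank vanishes. -/
theorem fusionRank_eq {j : ℕ} [NeZero j] (hj : j < p) (n : ℕ) (hn : n + 1 < p) (i : ℕ)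
    (hi : i + 1 ≤ p) :
    fusionRank k p (i + 1) (n + 1) j = if FusionRule p (n + 1) (i + 1) j then 1 else 0 := by
  have hj0 := NeZero.pos j
  induction n using Nat.strong_induction_on generalizing i with
  | _ n ih =>
    rcases eq_or_lt_of_le hi with hp | hp
    · have h := fusionRank_prime k p (n + 1) hj
      refine Eq.trans (by simp only [hp]) (h.trans (if_neg ?_).symm)
      unfold FusionRule
      omega
    match n, i with
    | 0, i =>
      rw [fusionRank_one, repRank_vRep k p hi hj.le]
      unfold FusionRule
      congr 1
      apply propext
      omega
    | n + 1, 0 =>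
      rw [fusionRank_comm, fusionRank_one, repRank_vRep k p (by omega) hj.le]
      unfold FusionRule
      congr 1
      apply propext
      omega
    -- Second factor `V_2`: the recursion produces second factors of index at least 3, so this case
    -- is read off the splitting itself.
    | 1, i + 1 =>
      have h := repRank_splitting k p (m := i) (natCast_ne_zero k p (by omega) (by omega)) j
      rw [repRank_vRep k p (by omega) hj.le, repRank_vRep k p (by omega) hj.le] at h
      exact h.trans (FusionRule.two p hp hj)
    | n + 2, i + 1 =>
      have h := fusionRank_recursion k p (l := i) (m := n)
        (natCast_ne_zero k p (by omega) (by omega)) (natCast_ne_zero k p (by omega) (by omega)) j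
      have h1 := ih (n + 1) (by omega) (by omega) (i + 2) (by omega)
      have h2 := ih (n + 1) (by omega) (by omega) i (by omega)
      have h3 := ih n (by omega) (by omega) (i + 1) (by omega)
      have h4 : fusionRank k p (i + 2) (n + 3) j =
          fusionRank k p (i + 3) (n + 2) j + fusionRank k p (i + 1) (n + 2) j -
            fusionRank k p (i + 2) (n + 1) j := by omega
      refine h4.trans ?_
      rw [h1, h2, h3]
      exact (FusionRule.recursion p n i j hp).symm

/-- The matrix `A⁽ⁿ⁾` is given by the truncated Clebsch-Gordan rule. -/
theorem A_apply {n : ℕ} (hn1 : 1 ≤ n) (hn : n ≤ p - 1) (i j : Vertex p) :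
    A k p n i j = if FusionRule p n i j then 1 else 0 := by
  have hp0 : 0 < p := (Fact.out : p.Prime).pos
  obtain ⟨i, hi1, hi⟩ := i
  obtain ⟨j, hj1, hj⟩ := j
  have : NeZero j := ⟨by omega⟩
  obtain ⟨n, rfl⟩ : ∃ m, n = m + 1 := ⟨n - 1, by omega⟩
  obtain ⟨i, rfl⟩ : ∃ m, i = m + 1 := ⟨i - 1, by omega⟩
  refine Eq.trans ?_ (fusionRank_eq k p (j := j) (by omega) n (by omega) i (by omega))
  have hj' : j ≤ p := by omega
  exact (hasScalarEnd_vRep_of_le k p hj').multiplicity_eq_repRank _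

end FusionRule
end SL2Tensor

namespace SL2Tensor

/-! ### The graph -/

section GraphOfFusionRule

theorem FusionRule.symm {p n i j : ℕ} (h : FusionRule p n i j) : FusionRule p n j i := by
  unfold FusionRule at *; omega

variable {p n : ℕ}

theorem mem_oddVertices (i : Vertex p) : i ∈ oddVertices p ↔ (i : ℕ) % 2 = 1 := Nat.odd_iff

theorem mem_evenVertices (i : Vertex p) : i ∈ evenVertices p ↔ (i : ℕ) % 2 = 0 := Nat.even_iff

/-- The reflection exchanges `i < j + n` with `j < i + n`, and `n < i + j` with `i + j + n < 2p`. -/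
theorem FusionRule.sub {i j : ℕ} (hi : i ≤ p) (hj : j ≤ p) :
    FusionRule p n (p - i) (p - j) ↔ FusionRule p n i j := by
  unfold FusionRule; omega

theorem FusionRule.sub_left {i j : ℕ} (hi : i ≤ p) (hj : j ≤ p) :
    FusionRule p n (p - i) j ↔ FusionRule p n i (p - j) := by
  unfold FusionRule; omega

/-! ### Positions in the block matrix -/

theorem ordering_blockPosition_zero (hp : Odd p) (i : Fin ((p - 1) / 2)) :
    ordering p hp (blockPosition p hp (i, 0)) = oddVertex p i := by
  have hi := i.2
  have h : ((blockPosition p hp (i, 0) : Fin (p - 1)) : ℕ) = i := by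
    simp [blockPosition, finProdFinEquiv]
  ext
  change ((if h : 2 * ((blockPosition p hp (i, 0) : Fin (p - 1)) : ℕ) < p - 1 then _ else _ :
    Vertex p) : ℕ) = 2 * i + 1
  rw [dif_pos (by rw [h]; omega)]
  simp [h]

theorem ordering_blockPosition_one (hp : Odd p) (i : Fin ((p - 1) / 2)) :
    ordering p hp (blockPosition p hp (i, 1)) = evenVertex p i := by
  have hi := i.2
  have hp' := Nat.odd_iff.1 hp
  have h : ((blockPosition p hp (i, 1) : Fin (p - 1)) : ℕ) = i + (p - 1) / 2 := by
    simp [blockPosition, finProdFinEquiv]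
  ext
  change ((if h : 2 * ((blockPosition p hp (i, 1) : Fin (p - 1)) : ℕ) < p - 1 then _ else _ :
    Vertex p) : ℕ) = p + 1 - 2 * (i + 1)
  rw [dif_neg (by rw [h]; omega)]
  simp only [h]
  omega

/-- The ordering is chosen so that corresponding positions of the two blocks are exchanged by `i ↦ p
- i`. -/
theorem evenVertex_eq_sub (i : Fin ((p - 1) / 2)) :
    (evenVertex p i : ℕ) = p - (oddVertex p i : ℕ) := by
  change p + 1 - 2 * ((i : ℕ) + 1) = p - (2 * (i : ℕ) + 1)
  omega

theorem swap_pow_of_odd (hodd : Odd n) :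
    (!![0, 1; 1, 0] : Matrix (Fin 2) (Fin 2) ℕ) ^ (n + 1) = 1 := by
  obtain ⟨m, rfl⟩ := hodd
  have h : (!![0, 1; 1, 0] : Matrix (Fin 2) (Fin 2) ℕ) ^ 2 = 1 := by decide
  rw [show 2 * m + 1 + 1 = 2 * (m + 1) by ring, pow_mul, h, one_pow]

theorem swap_pow_of_even (heven : Even n) :
    (!![0, 1; 1, 0] : Matrix (Fin 2) (Fin 2) ℕ) ^ (n + 1) = !![0, 1; 1, 0] := by
  obtain ⟨m, rfl⟩ := heven
  have h : (!![0, 1; 1, 0] : Matrix (Fin 2) (Fin 2) ℕ) ^ 2 = 1 := by decide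
  rw [pow_succ, ← two_mul, pow_mul, h, one_pow, one_mul]

/-! ### Adjacency, components and the block form of `A` -/

variable (k : Type*) [Field k] [CharP k p] [Fact p.Prime]

theorem graph_adj (hn1 : 1 ≤ n) (hn : n ≤ p - 1) (i j : Vertex p) :
    (graph k p n).Adj i j ↔ FusionRule p n i j := by
  change A k p n i j ≠ 0 ↔ _
  rw [A_apply k p hn1 hn]
  split_ifs with h <;> simp [h]

theorem simpleGraph_adj (hn1 : 1 ≤ n) (hn : n ≤ p - 1) (i j : Vertex p) :
    (simpleGraph k p n).Adj i j ↔ i ≠ j ∧ FusionRule p n i j := by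
  change (SimpleGraph.fromRel _).Adj i j ↔ _
  rw [SimpleGraph.fromRel_adj, graph_adj k hn1 hn, graph_adj k hn1 hn]
  exact and_congr_right fun _ => ⟨fun h => h.elim id FusionRule.symm, Or.inl⟩

theorem reachable_of_fusionRule (hn1 : 1 ≤ n) (hn : n ≤ p - 1) {i j : Vertex p}
    (h : FusionRule p n i j) : (simpleGraph k p n).Reachable i j := by
  by_cases hij : i = j
  · rw [hij]
  · exact ((simpleGraph_adj k hn1 hn i j).2 ⟨hij, h⟩).reachable

theorem mod_two_eq_of_reachable (hn1 : 1 ≤ n) (hn : n ≤ p - 1) (hodd : Odd n) {i j : Vertex p}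
    (h : (simpleGraph k p n).Reachable i j) : (i : ℕ) % 2 = (j : ℕ) % 2 := by
  obtain ⟨w⟩ := h
  induction w with
  | nil => rfl
  | cons h _ ih =>
    have h1 := ((simpleGraph_adj k hn1 hn _ _).1 h).2.1
    rw [← ih]
    rw [Nat.odd_iff] at hodd
    omega

/-- A walk of length at most two passes through the smallest neighbour `|i + 2 - n| + 1` of `i + 2`
if `n ≤ i + 1`, and through the smallest neighbour `|i - n| + 1` of `i` otherwise. Both bounds on
`n` are needed: for `n = 1` the only edges are loops, and for `n = p - 1` the vertex `i` is adjacent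
to `p - i` alone. -/
theorem reachable_add_two (hn2 : 2 ≤ n) (hn : n < p - 1) {i j : Vertex p}
    (h : (j : ℕ) = i + 2) : (simpleGraph k p n).Reachable i j := by
  obtain ⟨i, hi1, hi⟩ := i
  obtain ⟨j, hj1, hj⟩ := j
  dsimp only at h
  by_cases hin : n ≤ i + 1
  · refine (reachable_of_fusionRule k (j := ⟨i + 3 - n, by omega, by omega⟩) (by omega) hn.le
      ?_).trans (reachable_of_fusionRule k (by omega) hn.le ?_) <;>
    · simp only [FusionRule]
      omega
  · refine (reachable_of_fusionRule k (j := ⟨n - i + 1, by omega, by omega⟩) (by omega) hn.le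
      ?_).trans (reachable_of_fusionRule k (by omega) hn.le ?_) <;>
    · simp only [FusionRule]
      omega

theorem reachable_add_two_mul (hn2 : 2 ≤ n) (hn : n < p - 1) (d : ℕ) {i j : Vertex p}
    (h : (j : ℕ) = i + 2 * d) : (simpleGraph k p n).Reachable i j := by
  induction d generalizing j with
  | zero => rw [show i = j from Subtype.ext h.symm]
  | succ d ih =>
    have hj := j.2.2
    have hi := i.2.1
    exact (ih (j := ⟨i + 2 * d, by omega, by omega⟩) rfl).trans
      (reachable_add_two k hn2 hn (by rw [h]; ring))

theorem reachable_of_mod_two_eq (hn2 : 2 ≤ n) (hn : n < p - 1) {i j : Vertex p}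
    (h : (i : ℕ) % 2 = (j : ℕ) % 2) : (simpleGraph k p n).Reachable i j := by
  rcases le_total (i : ℕ) j with hij | hij
  · exact reachable_add_two_mul k hn2 hn (((j : ℕ) - i) / 2) (by omega)
  · exact (reachable_add_two_mul k hn2 hn (((i : ℕ) - j) / 2) (by omega)).symm

theorem connected_of_even (hn2 : 2 ≤ n) (hn : n < p - 1) (heven : Even n) :
    (simpleGraph k p n).Connected := by
  rw [Nat.even_iff] at heven
  let one : Vertex p := ⟨1, by omega, by omega⟩
  -- Since `V_1 ⊗ V_n` is `V_n`, there is an edge from 1 to the even vertex `n`, which joins the two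
  -- parity classes.
  have h1n : (simpleGraph k p n).Reachable one ⟨n, by omega, by omega⟩ :=
    reachable_of_fusionRule k (by omega) hn.le (by simp only [FusionRule, one]; omega)
  have key : ∀ i : Vertex p, (simpleGraph k p n).Reachable one i := by
    intro i
    rcases Nat.mod_two_eq_zero_or_one i with h | h
    · exact h1n.trans (reachable_of_mod_two_eq k hn2 hn (by rw [h]; exact heven))
    · exact reachable_of_mod_two_eq k hn2 hn h.symm
  exact { preconnected := fun i j => (key i).symm.trans (key j), nonempty := ⟨one⟩ }

theorem not_connected_of_odd (hp : Odd p) (hn1 : 1 ≤ n) (hn : n ≤ p - 1) (hodd : Odd n) :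
    ¬ (simpleGraph k p n).Connected := by
  intro h
  have hp1 : 3 ≤ p := by
    have h2 := (Fact.out : p.Prime).two_le
    rw [Nat.odd_iff] at hp
    omega
  have := mod_two_eq_of_reachable k hn1 hn hodd
    (h.preconnected ⟨1, by omega, by omega⟩ ⟨2, by omega, by omega⟩)
  simp at this

theorem supp_subset_of_odd (hn1 : 1 ≤ n) (hn : n ≤ p - 1) (hodd : Odd n)
    (c : (simpleGraph k p n).ConnectedComponent) :
    c.supp ⊆ oddVertices p ∨ c.supp ⊆ evenVertices p := by
  induction c using SimpleGraph.ConnectedComponent.ind with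
  | _ v =>
    have key : ∀ w ∈ ((simpleGraph k p n).connectedComponentMk v).supp, (w : ℕ) % 2 = v % 2 :=
      fun w hw => mod_two_eq_of_reachable k hn1 hn hodd (SimpleGraph.ConnectedComponent.exact hw)
    rcases Nat.mod_two_eq_zero_or_one v with h | h
    · exact Or.inr fun w hw => (mem_evenVertices w).2 (by rw [key w hw, h])
    · exact Or.inl fun w hw => (mem_oddVertices w).2 (by rw [key w hw, h])

theorem range_supp_of_odd (hn2 : 1 < n) (hn : n < p - 1) (hodd : Odd n) :
    Set.range (fun c : (simpleGraph k p n).ConnectedComponent => c.supp) =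
      {oddVertices p, evenVertices p} := by
  have key : ∀ v w : Vertex p, w ∈ ((simpleGraph k p n).connectedComponentMk v).supp ↔
      (w : ℕ) % 2 = v % 2 := fun v w => by
    rw [SimpleGraph.ConnectedComponent.mem_supp_iff, SimpleGraph.ConnectedComponent.eq]
    exact ⟨mod_two_eq_of_reachable k hn2.le hn.le hodd, reachable_of_mod_two_eq k hn2 hn⟩
  have hoddv : ∀ v : Vertex p, (v : ℕ) % 2 = 1 →
      ((simpleGraph k p n).connectedComponentMk v).supp = oddVertices p := fun v hv => by
    ext w
    rw [key, mem_oddVertices, hv]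
  have hevenv : ∀ v : Vertex p, (v : ℕ) % 2 = 0 →
      ((simpleGraph k p n).connectedComponentMk v).supp = evenVertices p := fun v hv => by
    ext w
    rw [key, mem_evenVertices, hv]
  ext S
  constructor
  · rintro ⟨c, rfl⟩
    induction c using SimpleGraph.ConnectedComponent.ind with
    | _ v =>
      rcases Nat.mod_two_eq_zero_or_one v with h | h
      exacts [Or.inr (hevenv v h), Or.inl (hoddv v h)]
  · rintro (rfl | rfl)
    exacts [⟨_, hoddv ⟨1, by omega, by omega⟩ rfl⟩,
      ⟨_, hevenv ⟨2, by omega, by omega⟩ (Nat.mod_self 2)⟩]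

theorem card_connectedComponent_of_odd (hn2 : 1 < n) (hn : n < p - 1) (hodd : Odd n) :
    Nat.card (simpleGraph k p n).ConnectedComponent = 2 := by
  have hne : oddVertices p ≠ evenVertices p := by
    intro h
    have h1 : (⟨1, by omega, by omega⟩ : Vertex p) ∈ oddVertices p := odd_one
    rw [h, mem_evenVertices] at h1
    simp at h1
  rw [← Set.ncard_pair hne, ← range_supp_of_odd k hn2 hn hodd, ← Nat.card_coe_set_eq]
  exact Nat.card_congr (Equiv.ofInjective _ SimpleGraph.ConnectedComponent.supp_injective)

theorem inducedIso_of_fusionRule (hp : Odd p) (hn1 : 1 ≤ n) (hn : n ≤ p - 1) :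
    InducedIso k p n (oddVertices p) (evenVertices p) := by
  rw [Nat.odd_iff] at hp
  -- As `p` is odd, the reflection `i ↦ p - i` exchanges the parities.
  let f : Vertex p → Vertex p := fun i =>
    ⟨p - i, by have := i.2.1; have := i.2.2; constructor <;> omega⟩
  have hf : ∀ i, f (f i) = i := fun i => Subtype.ext (by
    have := i.2.2
    change p - (p - (i : ℕ)) = i
    omega)
  refine ⟨⟨⟨fun i => ⟨f i, ?_⟩, fun i => ⟨f i, ?_⟩, fun i => Subtype.ext (hf i),
    fun i => Subtype.ext (hf i)⟩, ?_⟩⟩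
  · have h := (mem_oddVertices _).1 i.2
    have := i.1.2.2
    rw [mem_evenVertices]
    change (p - (i.1 : ℕ)) % 2 = 0
    omega
  · have h := (mem_evenVertices _).1 i.2
    have := i.1.2.2
    rw [mem_oddVertices]
    change (p - (i.1 : ℕ)) % 2 = 1
    omega
  · intro a b
    change (graph k p n).Adj (f a) (f b) ↔ (graph k p n).Adj a b
    rw [graph_adj k hn1 hn, graph_adj k hn1 hn]
    exact FusionRule.sub (by have := a.1.2.2; omega) (by have := b.1.2.2; omega)

theorem isBipartite_of_even (hn1 : 1 ≤ n) (hn : n ≤ p - 1) (heven : Even n) :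
    IsBipartiteWithClasses k p n (oddVertices p) (evenVertices p) := by
  rw [Nat.even_iff] at heven
  constructor
  · rw [isCompl_comm]
    have : evenVertices p = (oddVertices p)ᶜ := by
      ext i
      rw [Set.mem_compl_iff, mem_oddVertices, mem_evenVertices]
      omega
    rw [this]
    exact isCompl_compl.symm
  · intro i j hij
    have h := ((graph_adj k hn1 hn i j).1 hij).1
    simp only [mem_oddVertices, mem_evenVertices]
    omega

theorem A_eq_zero_of_parity (hn1 : 1 ≤ n) (hn : n ≤ p - 1) {i j : Vertex p}
    (h : ((i : ℕ) + j + n) % 2 = 0) : A k p n i j = 0 := by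
  rw [A_apply k p hn1 hn, if_neg]
  unfold FusionRule
  omega

-- Parity makes two of the four blocks vanish: the off-diagonal ones for odd `n`, the diagonal ones
-- for even `n`. The reflection `i ↦ p - i` identifies the remaining two, and the power of the swap
-- matrix is the identity or the swap accordingly.
open scoped Kronecker in
theorem A_submatrix_ordering (hp : Odd p) (hn1 : 1 ≤ n) (hn : n ≤ p - 1) :
    (A k p n).submatrix (ordering p hp) (ordering p hp) =
      Matrix.reindex (blockPosition p hp) (blockPosition p hp)
        (ABar k p n ⊗ₖ ((!![0, 1; 1, 0] : Matrix (Fin 2) (Fin 2) ℕ) ^ (n + 1))) := by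
  have hp' := Nat.odd_iff.1 hp
  have hoddv : ∀ i, (oddVertex p i : ℕ) % 2 = 1 := fun i => by
    change (2 * (i : ℕ) + 1) % 2 = 1
    omega
  have hlt : ∀ i, (oddVertex p i : ℕ) ≤ p := fun i => (oddVertex p i).2.2.trans (Nat.sub_le _ _)
  have hevenv : ∀ i, (evenVertex p i : ℕ) % 2 = 0 := fun i => by
    have := hoddv i
    have := hlt i
    rw [evenVertex_eq_sub]
    omega
  have hAsub : ∀ i j, A k p n (evenVertex p i) (evenVertex p j) =
      A k p n (oddVertex p i) (oddVertex p j) := fun i j => by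
    rw [A_apply k p hn1 hn, A_apply k p hn1 hn]
    simp only [evenVertex_eq_sub, FusionRule.sub (hlt i) (hlt j)]
  have hAleft : ∀ i j, A k p n (evenVertex p i) (oddVertex p j) =
      A k p n (oddVertex p i) (evenVertex p j) := fun i j => by
    rw [A_apply k p hn1 hn, A_apply k p hn1 hn]
    simp only [evenVertex_eq_sub, FusionRule.sub_left (hlt i) (hlt j)]
  ext s t
  obtain ⟨⟨i, a⟩, rfl⟩ := (blockPosition p hp).surjective s
  obtain ⟨⟨j, b⟩, rfl⟩ := (blockPosition p hp).surjective t
  rw [Matrix.reindex_apply, Matrix.submatrix_apply, Matrix.submatrix_apply,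
    Equiv.symm_apply_apply, Equiv.symm_apply_apply, Matrix.kroneckerMap_apply]
  rcases Nat.even_or_odd n with hpar | hpar
  · have hABar : ABar k p n i j = A k p n (oddVertex p i) (evenVertex p j) :=
      if_neg (Nat.not_odd_iff_even.2 hpar)
    rw [swap_pow_of_even hpar, hABar]
    rw [Nat.even_iff] at hpar
    fin_cases a <;> fin_cases b <;>
      simp only [Fin.zero_eta, Fin.mk_one, ordering_blockPosition_zero,
        ordering_blockPosition_one, Matrix.of_apply, Matrix.cons_val', Matrix.cons_val_zero,
        Matrix.cons_val_one, Matrix.cons_val_fin_one, mul_zero, mul_one, hAleft]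
    · exact A_eq_zero_of_parity k hn1 hn (by have := hoddv i; have := hoddv j; omega)
    · exact A_eq_zero_of_parity k hn1 hn (by have := hevenv i; have := hevenv j; omega)
  · have hABar : ABar k p n i j = A k p n (oddVertex p i) (oddVertex p j) := if_pos hpar
    rw [swap_pow_of_odd hpar, hABar]
    rw [Nat.odd_iff] at hpar
    fin_cases a <;> fin_cases b <;>
      simp only [Fin.zero_eta, Fin.mk_one, ordering_blockPosition_zero,
        ordering_blockPosition_one, Matrix.one_apply_eq, ne_eq, zero_ne_one, one_ne_zero,
        not_false_eq_true, Matrix.one_apply_ne, mul_zero, mul_one, hAsub]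
    · exact A_eq_zero_of_parity k hn1 hn (by have := hoddv i; have := hevenv j; omega)
    · exact A_eq_zero_of_parity k hn1 hn (by have := hevenv i; have := hoddv j; omega)

theorem A_isSymm (hn1 : 1 ≤ n) (hn : n ≤ p - 1) : (A k p n).IsSymm := by
  ext i j
  rw [Matrix.transpose_apply, A_apply k p hn1 hn, A_apply k p hn1 hn]
  exact if_congr ⟨FusionRule.symm, FusionRule.symm⟩ rfl rfl

theorem A_le_one (hn1 : 1 ≤ n) (hn : n ≤ p - 1) (i j : Vertex p) : A k p n i j ≤ 1 := by
  rw [A_apply k p hn1 hn]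
  split_ifs <;> omega

end GraphOfFusionRule

end SL2Tensor

open scoped Kronecker in
theorem proposition4p10 (k : Type*) [Field k] [IsAlgClosed k] (p : ℕ) [Fact p.Prime] [CharP k p]
    (hp : Odd p) (n : ℕ) (hn1 : 1 ≤ n) (hn : n ≤ p - 1) :
    -- `A` is a symmetric `0`-`1` matrix, so `𝒢` is an undirected graph with adjacency matrix `A`
    ((SL2Tensor.A k p n).IsSymm ∧ ∀ i j, SL2Tensor.A k p n i j ≤ 1) ∧
    -- `n` odd: `𝒢` is disconnected, and each component consists of vertices of one parity
    (Odd n → ¬ (SL2Tensor.simpleGraph k p n).Connected ∧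
      ∀ c : (SL2Tensor.simpleGraph k p n).ConnectedComponent,
        c.supp ⊆ SL2Tensor.oddVertices p ∨ c.supp ⊆ SL2Tensor.evenVertices p) ∧
    -- `n` even: `𝒢` is bipartite with classes the odd and the even vertices
    (Even n → SL2Tensor.IsBipartiteWithClasses k p n
      (SL2Tensor.oddVertices p) (SL2Tensor.evenVertices p)) ∧
    -- in the ordering `1, 3, …, p - 2, p - 1, …, 4, 2`, `A` is a Kronecker product
    (SL2Tensor.A k p n).submatrix (SL2Tensor.ordering p hp) (SL2Tensor.ordering p hp) =
      Matrix.reindex (SL2Tensor.blockPosition p hp) (SL2Tensor.blockPosition p hp)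
        (SL2Tensor.ABar k p n ⊗ₖ ((!![0, 1; 1, 0] : Matrix (Fin 2) (Fin 2) ℕ) ^ (n + 1))) ∧
    -- `n > 1` odd: there are exactly two components, the odd and the even vertices, isomorphic
    (Odd n → 1 < n →
      Nat.card (SL2Tensor.simpleGraph k p n).ConnectedComponent = 2 ∧
      Set.range (fun c : (SL2Tensor.simpleGraph k p n).ConnectedComponent => c.supp) =
        {SL2Tensor.oddVertices p, SL2Tensor.evenVertices p} ∧
      SL2Tensor.InducedIso k p n (SL2Tensor.oddVertices p) (SL2Tensor.evenVertices p)) ∧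
    -- `n < p - 1` even: `𝒢` is connected
    (Even n → n < p - 1 → (SL2Tensor.simpleGraph k p n).Connected) := by
  -- The number `p - 1` is even, so an odd `n ≤ p - 1` is strictly smaller.
  have hlt : Odd n → n < p - 1 := fun h => by
    rw [Nat.odd_iff] at h hp
    omega
  exact ⟨⟨SL2Tensor.A_isSymm k hn1 hn, SL2Tensor.A_le_one k hn1 hn⟩,
    fun h => ⟨SL2Tensor.not_connected_of_odd k hp hn1 hn h,
      SL2Tensor.supp_subset_of_odd k hn1 hn h⟩,
    SL2Tensor.isBipartite_of_even k hn1 hn,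
    SL2Tensor.A_submatrix_ordering k hp hn1 hn,
    fun h h1 => ⟨SL2Tensor.card_connectedComponent_of_odd k h1 (hlt h) h,
      SL2Tensor.range_supp_of_odd k h1 (hlt h) h,
      SL2Tensor.inducedIso_of_fusionRule k hp hn1 hn⟩,
    fun h h1 => SL2Tensor.connected_of_even k (by rw [Nat.even_iff] at h; omega) h1 h⟩
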